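/- Let $R$ be an integral domain, let $q,\lambda,x,q_0$ be units of $R$ such that $\delta:=q-q^{-1}$ is a unit, and let $q_1,A\in R$. Assume $$x\delta=\delta-\lambda+\lambda^{-1},\qquad A(1-q_0\lambda)=q_1x,\qquad q_0=q^{-1}.$$ Let $n\ge 1$. Let ${\rm BA}_n$ be the unital associative $R$-algebra generated by invertible $X_1,\dots,X_{n-1}$ subject to the following relations, where $e_i:=1-\delta^{-1}(X_i-X_i^{-1})$: $$X_iX_j=X_jX_i\ (|i-j|>1),\qquad X_iX_jX_i=X_jX_iX_j\ (|i-j|=1),\qquad X_ie_i=e_iX_i=\lambda e_i,\qquad e_iX_{i-1}^{\pm1}e_i=\lambda^{\mp1}e_i\ (i\ge 2).$$ Let ${\rm BB}_n$ be the unital associative $R$-algebra generated by invertible $Y,X_1,\dots,X_{n-1}$ subject to the same relations and $$X_1YX_1Y=YX_1YX_1,\quad Y^2=q_1Y+q_0,\quad YX_1Ye_1=e_1,\quad YX_i=X_iY\ (i>1),\quad e_1Ye_1=Ae_1$$ (relations that involve $X_1$ or $e_1$ being omitted for $n=1$). For $1\le i\le n$ put $Y'_i:=X_{i-1}\cdots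 X_1YX_1\cdots X_{i-1}$. Let $\iota:{\rm BA}_n\to{\rm BB}_n$ be the homomorphism with $\iota(X_i)=X_i$. For a subset $B\subseteq{\rm BA}_n$ let $N(B)\subseteq {\rm BB}_n$ be the set of all elements $\alpha\beta\gamma$ where $\alpha$ is a product of elements $Y'_i$, $\gamma$ is a product of elements $Y_i'^{-1}$ (repetitions and empty products are allowed), $\alpha$ and $\gamma$ together have at most $n$ factors, and $\beta\in\iota(B)$. Then: 1. If $B$ spans ${\rm BA}_n$ over $R$ (in particular, if $B$ is a basis of ${\rm BA}_n$), then $N(B)$ spans ${\rm BB}_n$ over $R$. 2. ${\rm BB}_n$ is spanned over $R$ by at most $2^n(2n-1)!!$ elements of $N({\rm BA}_n)$. In particular the rank of the $R$-module ${\rm BB}_n$ is at most $2^n(2n-1)!!$. 3. If $R$ is a field and $B$ is a basis of ${\rm BA}_n$, then ${\rm BB}_n$ has a basis contained in $N(B)$, and $\dim_R{\rm BB}_n\le 2^n(2n-1)!!$. -/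

import Mathlib

namespace BMW

/-- Parameters of the Birman-Wenzl algebra of type A: units `q, lam, x, del` of `R`
with `del = q - q⁻¹` and `x * del = del - lam + lam⁻¹`. -/
structure ParamsA (R : Type*) [CommRing R] where
  q : Rˣ
  lam : Rˣ
  x : Rˣ
  del : Rˣ
  del_eq : (del : R) = (q : R) - ((q⁻¹ : Rˣ) : R)
  x_rel : (x : R) * (del : R) = (del : R) - (lam : R) + ((lam⁻¹ : Rˣ) : R)

/-- Parameters of the reduced Birman-Wenzl algebra of type B. -/
structure ParamsB (R : Type*) [CommRing R] extends ParamsA R where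
  q0 : Rˣ
  q1 : R
  A : R

/-- The element `e = 1 - (X - X⁻¹) / del`, where `Xi` is meant to be the inverse of `X`. -/
def eOf {R : Type*} [CommRing R] (p : ParamsA R) {S : Type*} [Ring S] [Algebra R S]
    (X Xi : S) : S :=
  1 - ((p.del⁻¹ : Rˣ) : R) • (X - Xi)

theorem map_eOf {R : Type*} [CommRing R] (p : ParamsA R) {S T : Type*} [Ring S] [Algebra R S]
    [Ring T] [Algebra R T] (f : S →ₐ[R] T) (X Xi : S) :
    f (eOf p X Xi) = eOf p (f X) (f Xi) := by
  simp [eOf]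

/-- Generators of the type A algebra on `n` strands. The index `i : Fin (n - 1)` is zero-based:
`X i` is usually written `X_{i+1}`. -/
inductive GenA (n : ℕ) : Type
  | X (i : Fin (n - 1)) : GenA n
  | Xinv (i : Fin (n - 1)) : GenA n

/-- Generators of the type B algebra on `n` strands, with the same zero-based indexing. -/
inductive GenB (n : ℕ) : Type
  | X (i : Fin (n - 1)) : GenB n
  | Xinv (i : Fin (n - 1)) : GenB n
  | Y : GenB n
  | Yinv : GenB n

section free

variable {R : Type*} [CommRing R]

/-- The generator `X_{i+1}` in the free algebra. -/
abbrev fX (R : Type*) [CommRing R] {n : ℕ} (i : Fin (n - 1)) : FreeAlgebra R (GenA n) :=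
  FreeAlgebra.ι R (GenA.X i)

/-- The generator `X_{i+1}⁻¹` in the free algebra. -/
abbrev fXi (R : Type*) [CommRing R] {n : ℕ} (i : Fin (n - 1)) : FreeAlgebra R (GenA n) :=
  FreeAlgebra.ι R (GenA.Xinv i)

/-- The element `e_{i+1}` in the free algebra. -/
abbrev fe (p : ParamsA R) {n : ℕ} (i : Fin (n - 1)) : FreeAlgebra R (GenA n) :=
  eOf p (fX R i) (fXi R i)

/-- Defining relations of the type A algebra. -/
inductive RelA (p : ParamsA R) (n : ℕ) :
    FreeAlgebra R (GenA n) → FreeAlgebra R (GenA n) → Prop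
  | X_mul_Xinv (i : Fin (n - 1)) : RelA p n (fX R i * fXi R i) 1
  | Xinv_mul_X (i : Fin (n - 1)) : RelA p n (fXi R i * fX R i) 1
  | comm (i j : Fin (n - 1)) (h : (i : ℕ) + 1 < j ∨ (j : ℕ) + 1 < i) :
      RelA p n (fX R i * fX R j) (fX R j * fX R i)
  | braid (i j : Fin (n - 1)) (h : (i : ℕ) + 1 = j ∨ (j : ℕ) + 1 = i) :
      RelA p n (fX R i * fX R j * fX R i) (fX R j * fX R i * fX R j)
  | X_mul_e (i : Fin (n - 1)) : RelA p n (fX R i * fe p i) ((p.lam : R) • fe p i)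
  | e_mul_X (i : Fin (n - 1)) : RelA p n (fe p i * fX R i) ((p.lam : R) • fe p i)
  | e_X_e (i j : Fin (n - 1)) (h : (j : ℕ) + 1 = i) :
      RelA p n (fe p i * fX R j * fe p i) (((p.lam⁻¹ : Rˣ) : R) • fe p i)
  | e_Xinv_e (i j : Fin (n - 1)) (h : (j : ℕ) + 1 = i) :
      RelA p n (fe p i * fXi R j * fe p i) ((p.lam : R) • fe p i)

/-- The generator `X_{i+1}` in the free algebra of type B. -/
abbrev gX (R : Type*) [CommRing R] {n : ℕ} (i : Fin (n - 1)) : FreeAlgebra R (GenB n) :=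
  FreeAlgebra.ι R (GenB.X i)

/-- The generator `X_{i+1}⁻¹` in the free algebra of type B. -/
abbrev gXi (R : Type*) [CommRing R] {n : ℕ} (i : Fin (n - 1)) : FreeAlgebra R (GenB n) :=
  FreeAlgebra.ι R (GenB.Xinv i)

/-- The generator `Y` in the free algebra of type B. -/
abbrev gY (R : Type*) [CommRing R] (n : ℕ) : FreeAlgebra R (GenB n) :=
  FreeAlgebra.ι R GenB.Y

/-- The generator `Y⁻¹` in the free algebra of type B. -/
abbrev gYi (R : Type*) [CommRing R] (n : ℕ) : FreeAlgebra R (GenB n) :=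
  FreeAlgebra.ι R GenB.Yinv

/-- The element `e_{i+1}` in the free algebra of type B. -/
abbrev ge (p : ParamsA R) {n : ℕ} (i : Fin (n - 1)) : FreeAlgebra R (GenB n) :=
  eOf p (gX R i) (gXi R i)

/-- Defining relations of the reduced type B algebra. The relations that involve `X_1` or `e_1`
are stated for an index `i` with value `0`. -/
inductive RelB (p : ParamsB R) (n : ℕ) :
    FreeAlgebra R (GenB n) → FreeAlgebra R (GenB n) → Prop
  | X_mul_Xinv (i : Fin (n - 1)) : RelB p n (gX R i * gXi R i) 1
  | Xinv_mul_X (i : Fin (n - 1)) : RelB p n (gXi R i * gX R i) 1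
  | Y_mul_Yinv : RelB p n (gY R n * gYi R n) 1
  | Yinv_mul_Y : RelB p n (gYi R n * gY R n) 1
  | comm (i j : Fin (n - 1)) (h : (i : ℕ) + 1 < j ∨ (j : ℕ) + 1 < i) :
      RelB p n (gX R i * gX R j) (gX R j * gX R i)
  | braid (i j : Fin (n - 1)) (h : (i : ℕ) + 1 = j ∨ (j : ℕ) + 1 = i) :
      RelB p n (gX R i * gX R j * gX R i) (gX R j * gX R i * gX R j)
  | X_mul_e (i : Fin (n - 1)) :
      RelB p n (gX R i * ge p.toParamsA i) ((p.lam : R) • ge p.toParamsA i)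
  | e_mul_X (i : Fin (n - 1)) :
      RelB p n (ge p.toParamsA i * gX R i) ((p.lam : R) • ge p.toParamsA i)
  | e_X_e (i j : Fin (n - 1)) (h : (j : ℕ) + 1 = i) :
      RelB p n (ge p.toParamsA i * gX R j * ge p.toParamsA i)
        (((p.lam⁻¹ : Rˣ) : R) • ge p.toParamsA i)
  | e_Xinv_e (i j : Fin (n - 1)) (h : (j : ℕ) + 1 = i) :
      RelB p n (ge p.toParamsA i * gXi R j * ge p.toParamsA i)
        ((p.lam : R) • ge p.toParamsA i)
  | XYXY (i : Fin (n - 1)) (h : (i : ℕ) = 0) :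
      RelB p n (gX R i * gY R n * gX R i * gY R n) (gY R n * gX R i * gY R n * gX R i)
  | Y_sq : RelB p n (gY R n * gY R n) (p.q1 • gY R n + algebraMap R _ (p.q0 : R))
  | YXYe (i : Fin (n - 1)) (h : (i : ℕ) = 0) :
      RelB p n (gY R n * gX R i * gY R n * ge p.toParamsA i) (ge p.toParamsA i)
  | Y_comm (i : Fin (n - 1)) (h : 0 < (i : ℕ)) :
      RelB p n (gY R n * gX R i) (gX R i * gY R n)
  | eYe (i : Fin (n - 1)) (h : (i : ℕ) = 0) :
      RelB p n (ge p.toParamsA i * gY R n * ge p.toParamsA i) (p.A • ge p.toParamsA i)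

end free

section algebras

variable {R : Type*} [CommRing R]

/-- The Birman-Wenzl algebra of type A on `n` strands. -/
abbrev BA (p : ParamsA R) (n : ℕ) : Type _ := RingQuot (RelA p n)

/-- The reduced Birman-Wenzl algebra of type B on `n` strands (for `n ≥ 1`). -/
abbrev BB (p : ParamsB R) (n : ℕ) : Type _ := RingQuot (RelB p n)

/-- The canonical map from the free algebra. -/
abbrev mkB (p : ParamsB R) (n : ℕ) : FreeAlgebra R (GenB n) →ₐ[R] BB p n :=
  RingQuot.mkAlgHom R (RelB p n)

/-- The unit `X_{i+1}` of the type B algebra. -/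
def X (p : ParamsB R) {n : ℕ} (i : Fin (n - 1)) : (BB p n)ˣ where
  val := mkB p n (gX R i)
  inv := mkB p n (gXi R i)
  val_inv := by
    rw [← map_mul, ← map_one (mkB p n)]
    exact RingQuot.mkAlgHom_rel R (RelB.X_mul_Xinv i)
  inv_val := by
    rw [← map_mul, ← map_one (mkB p n)]
    exact RingQuot.mkAlgHom_rel R (RelB.Xinv_mul_X i)

/-- The unit `Y` of the type B algebra. -/
def Y (p : ParamsB R) (n : ℕ) : (BB p n)ˣ where
  val := mkB p n (gY R n)
  inv := mkB p n (gYi R n)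
  val_inv := by
    rw [← map_mul, ← map_one (mkB p n)]
    exact RingQuot.mkAlgHom_rel R RelB.Y_mul_Yinv
  inv_val := by
    rw [← map_mul, ← map_one (mkB p n)]
    exact RingQuot.mkAlgHom_rel R RelB.Yinv_mul_Y

/-- `Y'_{k+1} = X_k ⋯ X_1 Y X_1 ⋯ X_k`, by recursion on `k`. -/
def yPrimeAux (p : ParamsB R) (n : ℕ) : (k : ℕ) → k < n → (BB p n)ˣ
  | 0, _ => Y p n
  | k + 1, h =>
      X p ⟨k, by omega⟩ * yPrimeAux p n k (by omega) * X p ⟨k, by omega⟩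

/-- The unit `Y'_{k+1}` of the type B algebra, for the zero-based index `k : Fin n`. -/
def yPrime (p : ParamsB R) {n : ℕ} (k : Fin n) : (BB p n)ˣ :=
  yPrimeAux p n k.1 k.2

/-- The map of free algebras that sends each generator `X_i^{±1}` to the one with the same name. -/
def freeAtoB (R : Type*) [CommRing R] (n : ℕ) :
    FreeAlgebra R (GenA n) →ₐ[R] FreeAlgebra R (GenB n) :=
  FreeAlgebra.lift R fun g =>
    match g with
    | GenA.X i => gX R i
    | GenA.Xinv i => gXi R i

theorem freeAtoB_X {n : ℕ} (i : Fin (n - 1)) : freeAtoB R n (fX R i) = gX R i := by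
  simp [freeAtoB]

theorem freeAtoB_Xi {n : ℕ} (i : Fin (n - 1)) : freeAtoB R n (fXi R i) = gXi R i := by
  simp [freeAtoB]

theorem freeAtoB_e (p : ParamsA R) {n : ℕ} (i : Fin (n - 1)) :
    freeAtoB R n (fe p i) = ge p i := by
  rw [map_eOf, freeAtoB_X, freeAtoB_Xi]

theorem relB_of_relA (p : ParamsB R) (n : ℕ) ⦃a b : FreeAlgebra R (GenA n)⦄
    (h : RelA p.toParamsA n a b) : RelB p n (freeAtoB R n a) (freeAtoB R n b) := by
  cases h <;> simp only [map_mul, map_one, map_smul, freeAtoB_X, freeAtoB_Xi, freeAtoB_e]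
  · exact RelB.X_mul_Xinv _
  · exact RelB.Xinv_mul_X _
  · exact RelB.comm _ _ ‹_›
  · exact RelB.braid _ _ ‹_›
  · exact RelB.X_mul_e _
  · exact RelB.e_mul_X _
  · exact RelB.e_X_e _ _ ‹_›
  · exact RelB.e_Xinv_e _ _ ‹_›

/-- The canonical homomorphism from the type A algebra to the type B algebra, `X_i ↦ X_i`. -/
noncomputable def toBB (p : ParamsB R) (n : ℕ) : BA p.toParamsA n →ₐ[R] BB p n :=
  RingQuot.liftAlgHom R
    ⟨(mkB p n).comp (freeAtoB R n), fun _ _ h =>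
      RingQuot.mkAlgHom_rel R (relB_of_relA p n h)⟩

/-- All elements `α β γ` of the type B algebra where `α` is a product of elements `Y'_k`, `γ` is a
product of elements `Y'_k⁻¹`, together with at most `n` factors, and `β` is the image of an
element of `B`. -/
def normalForms (p : ParamsB R) (n : ℕ) (B : Set (BA p.toParamsA n)) : Set (BB p n) :=
  {w | ∃ s t : List (Fin n), ∃ b ∈ B, s.length + t.length ≤ n ∧
    w = (s.map fun k => (yPrime p k : BB p n)).prod * toBB p n b *
      (t.map fun k => (((yPrime p k)⁻¹ : (BB p n)ˣ) : BB p n)).prod}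

end algebras

end BMW

/-! Picture diagrams of strands beside a pole, where `J k`, the element usually written `Y'_{k+1}`,
lets a strand wind around the pole. In a diagram on `k + 1` strands the last top point is joined
either to one of the `k + 1` bottom points or to one of the `k` other top points, and this strand
may carry a winding or not. Removing it leaves a diagram on `k` strands. So passing from `k` to `k +
1` strands costs a factor `2 * (k + 1) + 2 * k = 2 * (2 * k + 1)`, and the product over `k < n` is
`2 ^ n * (2 * n - 1)‼`.

The algebraic form of this removal is `algB_succ_le_peelSpan`. It combines two facts. By
`algB_succ_le_bridgeSpan` the algebra on `k + 1` strands is generated, as a bimodule over the one on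
`k` strands, by `1`, `(J k)⁻¹`, `(X (k - 1))⁻¹` and `e (k - 1)`. By `algB_le_leftStab_peelSpan` the
span of the peeled words is stable under left multiplication by the smaller algebra. Both rest on
tangle identities for adjacent generators and on `J_mul_J_mul_e`, which says that a winding slides
across a cup and becomes inverse.

The peeled words become normal forms by moving Jucys-Murphy elements outwards. Since `(J i)⁻¹ * (X
i)⁻¹ = X i * (J (i + 1))⁻¹`, such a factor crosses a strip of generators by changing one exponent
and raising its index. The indices stay distinct and each strand adds at most one factor, which
gives the bound `n` on their number. The middle factor has type A, so it can be expanded in any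
spanning set there. -/

namespace BMW

/-! ### Tangle identities for one generator and for two adjacent generators. -/

section pair

variable {R : Type*} [CommRing R] {S : Type*} [Ring S] [Algebra R S]

/-- The element `1 - (u - u⁻¹) / del` attached to a unit `u`. -/
def cupCap (p : ParamsA R) (u : Sˣ) : S := eOf p (u : S) ((u⁻¹ : Sˣ) : S)

theorem coe_inv_eq_skein (p : ParamsA R) (u : Sˣ) :
    ((u⁻¹ : Sˣ) : S) = u - (p.del : R) • (1 : S) + (p.del : R) • cupCap p u := by
  simp [cupCap, eOf, smul_sub, smul_smul]

theorem cupCap_conj (p : ParamsA R) {g : S} {u v : Sˣ} (h : g * u = v * g) :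
    g * cupCap p u = cupCap p v * g := by
  have h' : g * ((u⁻¹ : Sˣ) : S) = ((v⁻¹ : Sˣ) : S) * g := by
    rw [Units.eq_inv_mul_iff_mul_eq, ← mul_assoc, ← h, Units.mul_inv_cancel_right]
  simp [cupCap, eOf, mul_sub, sub_mul, h, h']

theorem commute_cupCap (p : ParamsA R) {g : S} {u : Sˣ} (h : Commute g u) :
    Commute g (cupCap p u) :=
  cupCap_conj p h

theorem cupCap_mem (p : ParamsA R) {T : Subalgebra R S} {u : Sˣ} (h : (u : S) ∈ T)
    (h' : ((u⁻¹ : Sˣ) : S) ∈ T) : cupCap p u ∈ T :=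
  T.sub_mem T.one_mem (T.smul_mem (T.sub_mem h h') _)

/-- A unit `u` that acts on `cupCap u` by the scalar `lam` on both sides. -/
structure IsKauffman (p : ParamsA R) (u : Sˣ) : Prop where
  mul_cupCap : (u : S) * cupCap p u = (p.lam : R) • cupCap p u
  cupCap_mul : cupCap p u * (u : S) = (p.lam : R) • cupCap p u

namespace IsKauffman

variable {p : ParamsA R} {u : Sˣ} (h : IsKauffman p u)
include h

theorem inv_mul_cupCap :
    ((u⁻¹ : Sˣ) : S) * cupCap p u = ((p.lam⁻¹ : Rˣ) : R) • cupCap p u := by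
  rw [Units.inv_mul_eq_iff_eq_mul, mul_smul_comm, h.mul_cupCap, smul_smul]
  simp

theorem cupCap_mul_inv :
    cupCap p u * ((u⁻¹ : Sˣ) : S) = ((p.lam⁻¹ : Rˣ) : R) • cupCap p u := by
  rw [Units.mul_inv_eq_iff_eq_mul, smul_mul_assoc, h.cupCap_mul, smul_smul]
  simp

theorem inv_mul_inv : ((u⁻¹ : Sˣ) : S) * ((u⁻¹ : Sˣ) : S) =
    1 - (p.del : R) • ((u⁻¹ : Sˣ) : S)
      + ((p.del : R) * ((p.lam⁻¹ : Rˣ) : R)) • cupCap p u := by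
  conv_lhs => enter [1]; rw [coe_inv_eq_skein p u]
  simp [add_mul, sub_mul, h.cupCap_mul_inv, smul_smul]

theorem mul_self : (u : S) * u =
    1 + (p.del : R) • (u : S) - ((p.del : R) * (p.lam : R)) • cupCap p u := by
  have h1 : (u : S) = ((u⁻¹ : Sˣ) : S) + (p.del : R) • (1 : S) - (p.del : R) • cupCap p u := by
    rw [coe_inv_eq_skein p u]; abel
  conv_lhs => enter [1]; rw [h1]
  simp [add_mul, sub_mul, h.cupCap_mul, smul_smul]

/-- Written out, `u * cupCap p u = lam • cupCap p u` is a cubic equation for `u` with invertible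
constant term, so the inverse is a quadratic polynomial in `u`. Hence subalgebras can be generated
without listing inverses. -/
theorem inv_mem {T : Subalgebra R S} (hu : (u : S) ∈ T) : ((u⁻¹ : Sˣ) : S) ∈ T := by
  have h1 := h.mul_cupCap
  have h2 : ((u⁻¹ : Sˣ) : S) = ((p.del : R) * ((p.lam⁻¹ : Rˣ) : R)) •
      ((u : S) - ((p.del⁻¹ : Rˣ) : R) • ((u : S) * u - 1)
        - (p.lam : R) • (1 - ((p.del⁻¹ : Rˣ) : R) • (u : S))) := by
    have h3 : (u : S) * cupCap p u = (u : S) - ((p.del⁻¹ : Rˣ) : R) • ((u : S) * u - 1) := by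
      simp [cupCap, eOf, mul_sub]
    rw [← h3, h1, cupCap, eOf]
    simp only [smul_sub, smul_smul]
    have e1 : (p.del : R) * ((p.lam⁻¹ : Rˣ) : R) * ((p.lam : R) * ((p.del⁻¹ : Rˣ) : R)) = 1 := by
      have := p.del.mul_inv; have := p.lam.mul_inv
      grind
    rw [← mul_assoc] at e1 ⊢
    simp only [e1, one_smul]
    abel
  rw [h2]
  exact T.smul_mem (T.sub_mem (T.sub_mem hu (T.smul_mem (T.sub_mem (T.mul_mem hu hu) T.one_mem) _))
    (T.smul_mem (T.sub_mem T.one_mem (T.smul_mem hu _)) _)) _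

theorem mem_of_inv_mem {T : Subalgebra R S} (hu : ((u⁻¹ : Sˣ) : S) ∈ T) : (u : S) ∈ T := by
  have h1 := h.inv_mul_cupCap
  have h2 : (u : S) = ((p.del : R) * (p.lam : R)) •
      (((p.lam⁻¹ : Rˣ) : R) • (1 + ((p.del⁻¹ : Rˣ) : R) • ((u⁻¹ : Sˣ) : S)) -
        ((u⁻¹ : Sˣ) : S) + ((p.del⁻¹ : Rˣ) : R) • (1 - ((u⁻¹ : Sˣ) : S) * ((u⁻¹ : Sˣ) : S))) := by
    have h3 : ((u⁻¹ : Sˣ) : S) * cupCap p u = ((u⁻¹ : Sˣ) : S) -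
        ((p.del⁻¹ : Rˣ) : R) • (1 - ((u⁻¹ : Sˣ) : S) * ((u⁻¹ : Sˣ) : S)) := by
      simp [cupCap, eOf, mul_sub]
    rw [sub_add, ← h3, h1, cupCap, eOf]
    simp only [smul_sub, smul_smul, smul_add]
    have e1 : (p.del : R) * (p.lam : R) * (((p.lam⁻¹ : Rˣ) : R) * ((p.del⁻¹ : Rˣ) : R)) = 1 := by
      have := p.del.mul_inv; have := p.lam.mul_inv
      grind
    rw [← mul_assoc] at e1 ⊢
    simp only [e1, one_smul]
    abel
  rw [h2]
  exact T.smul_mem (T.add_mem (T.sub_mem (T.smul_mem (T.add_mem T.one_mem (T.smul_mem hu _)) _) hu)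
    (T.smul_mem (T.sub_mem T.one_mem (T.mul_mem hu hu)) _)) _

end IsKauffman

/-- Two braided units that satisfy the relations of adjacent generators, except that only one
of the two delooping relations is required. -/
structure IsKauffmanPair (p : ParamsA R) (u v : Sˣ) : Prop where
  left : IsKauffman p u
  right : IsKauffman p v
  braid : u * v * u = v * u * v
  deloop : cupCap p v * u * cupCap p v = ((p.lam⁻¹ : Rˣ) : R) • cupCap p v
  deloop_inv : cupCap p v * ((u⁻¹ : Sˣ) : S) * cupCap p v = (p.lam : R) • cupCap p v

namespace IsKauffmanPair

variable {p : ParamsA R} {u v : Sˣ}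

/-- The half twist `u * v * u` exchanges `u` and `v` by conjugation, so it carries one pair of
delooping relations to the other. -/
theorem symm (h : IsKauffmanPair p u v) : IsKauffmanPair p v u := by
  set g : Sˣ := u * v * u with hg
  have g1 : (g : S) * u = v * g := by
    rw [hg, ← Units.val_mul, ← Units.val_mul]; congr 1
    rw [h.braid]; nth_rewrite 2 [← h.braid]; group
  have g2 : (g : S) * v = u * g := by
    rw [hg, ← Units.val_mul, ← Units.val_mul]; congr 1
    nth_rewrite 2 [h.braid]; group
  have g2' : (g : S) * ((v⁻¹ : Sˣ) : S) = ((u⁻¹ : Sˣ) : S) * g := by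
    rw [Units.eq_inv_mul_iff_mul_eq, ← mul_assoc, ← g2, Units.mul_inv_cancel_right]
  have g1' : (g : S) * ((u⁻¹ : Sˣ) : S) = ((v⁻¹ : Sˣ) : S) * g := by
    rw [Units.eq_inv_mul_iff_mul_eq, ← mul_assoc, ← g1, Units.mul_inv_cancel_right]
  have c1 := cupCap_conj p g1
  have c2 := cupCap_conj p g2
  refine ⟨h.right, h.left, h.braid.symm, ?_, ?_⟩
  · apply g.isUnit.mul_left_cancel
    rw [← mul_assoc, ← mul_assoc, c1, mul_assoc (cupCap p v), g2, ← mul_assoc,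
      mul_assoc _ (g : S), c1, ← mul_assoc, h.deloop, mul_smul_comm, c1, smul_mul_assoc]
  · apply g.isUnit.mul_left_cancel
    rw [← mul_assoc, ← mul_assoc, c1, mul_assoc (cupCap p v), g2', ← mul_assoc,
      mul_assoc _ (g : S), c1, ← mul_assoc, h.deloop_inv, mul_smul_comm, c1, smul_mul_assoc]

variable (h : IsKauffmanPair p u v)
include h

theorem mul_mul_cupCap_comm :
    (u : S) * v * cupCap p u = cupCap p v * (u * v) :=
  cupCap_conj p (by exact_mod_cast h.braid.trans (by group))

theorem inv_mul_inv_mul_cupCap_comm :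
    ((u⁻¹ : Sˣ) : S) * ((v⁻¹ : Sˣ) : S) * cupCap p u =
      cupCap p v * (((u⁻¹ : Sˣ) : S) * ((v⁻¹ : Sˣ) : S)) := by
  refine cupCap_conj p ?_
  have : u⁻¹ * v⁻¹ * u = v * (u⁻¹ * v⁻¹) := by
    have hb := h.braid
    rw [mul_assoc, inv_mul_eq_iff_eq_mul, inv_mul_eq_iff_eq_mul]
    calc u = v * u * v * u⁻¹ * v⁻¹ := by rw [← hb]; group
    _ = _ := by group
  exact_mod_cast this

/-- Write `E`, `F` for the elements of `u`, `v`. Then `lam • F = F * u⁻¹ * F` and `F * (u * v) = u *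
v * E` turn `lam • (u * v * E)` into `F * v * E = lam • (F * E)`. -/
theorem mul_mul_cupCap : (u : S) * v * cupCap p u = cupCap p v * cupCap p u := by
  have h1 := h.deloop_inv
  have h2 : (p.lam : R) • ((u : S) * v * cupCap p u) =
      (p.lam : R) • (cupCap p v * cupCap p u) := by
    rw [h.mul_mul_cupCap_comm, ← smul_mul_assoc, ← h1, mul_assoc _ (cupCap p v),
      ← h.mul_mul_cupCap_comm]
    simp only [mul_assoc, Units.inv_mul_cancel_left]
    rw [← mul_assoc, h.right.cupCap_mul, smul_mul_assoc]
  exact p.lam.isUnit.smul_left_cancel.1 h2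

theorem inv_mul_inv_mul_cupCap :
    ((u⁻¹ : Sˣ) : S) * ((v⁻¹ : Sˣ) : S) * cupCap p u = cupCap p v * cupCap p u := by
  have h1 := h.deloop
  have h2 : ((p.lam⁻¹ : Rˣ) : R) • (((u⁻¹ : Sˣ) : S) * ((v⁻¹ : Sˣ) : S) * cupCap p u) =
      ((p.lam⁻¹ : Rˣ) : R) • (cupCap p v * cupCap p u) := by
    rw [h.inv_mul_inv_mul_cupCap_comm, ← smul_mul_assoc, ← h1, mul_assoc _ (cupCap p v),
      ← h.inv_mul_inv_mul_cupCap_comm]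
    simp only [mul_assoc, Units.mul_inv_cancel_left]
    rw [← mul_assoc, h.right.cupCap_mul_inv, smul_mul_assoc]
  exact (p.lam⁻¹).isUnit.smul_left_cancel.1 h2

theorem cupCap_mul_mul : cupCap p v * (u * v) = cupCap p v * cupCap p u := by
  rw [← h.mul_mul_cupCap_comm, h.mul_mul_cupCap]

theorem cupCap_mul_inv_mul_inv :
    cupCap p v * (((u⁻¹ : Sˣ) : S) * ((v⁻¹ : Sˣ) : S)) = cupCap p v * cupCap p u := by
  rw [← h.inv_mul_inv_mul_cupCap_comm, h.inv_mul_inv_mul_cupCap]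

theorem right_mul_cupCap_left :
    (v : S) * cupCap p u = ((u⁻¹ : Sˣ) : S) * cupCap p v * cupCap p u := by
  rw [mul_assoc, ← h.mul_mul_cupCap]; simp [mul_assoc]

theorem right_inv_mul_cupCap_left :
    ((v⁻¹ : Sˣ) : S) * cupCap p u = u * cupCap p v * cupCap p u := by
  rw [mul_assoc, ← h.inv_mul_inv_mul_cupCap]; simp [mul_assoc]

theorem cupCap_right_mul_left :
    cupCap p v * u = cupCap p v * cupCap p u * ((v⁻¹ : Sˣ) : S) := by
  rw [← h.cupCap_mul_mul]; simp [mul_assoc]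

/-- Straightening a zigzag: replacing the last two factors by `u⁻¹ * v⁻¹ * cupCap p u` leaves a curl
that a delooping relation removes. -/
theorem cupCap_mul_cupCap_mul_cupCap :
    cupCap p u * cupCap p v * cupCap p u = cupCap p u := by
  rw [mul_assoc, ← h.inv_mul_inv_mul_cupCap, ← mul_assoc, ← mul_assoc, h.left.cupCap_mul_inv,
    smul_mul_assoc, smul_mul_assoc, h.symm.deloop_inv, smul_smul]
  simp

end IsKauffmanPair

end pair

end BMW

/-! ### Representations of the type B relations and their Jucys-Murphy elements. -/

namespace BMW

/-- Units `X 0, …, X (N - 1)` and `Y` of an algebra that satisfy the defining relations of the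
type B algebra on `N + 1` strands which are used to find spanning sets. -/
structure TypeBRep {R : Type*} [CommRing R] (p : ParamsB R) (S : Type*) [Ring S] [Algebra R S]
    (N : ℕ) where
  X : ℕ → Sˣ
  Y : Sˣ
  kauffman : ∀ i, i < N → IsKauffman p.toParamsA (X i)
  comm : ∀ i j, i + 1 < j → j < N → X i * X j = X j * X i
  pair : ∀ i, i + 1 < N → IsKauffmanPair p.toParamsA (X i) (X (i + 1))
  X_Y_X_Y : 0 < N → X 0 * Y * X 0 * Y = Y * X 0 * Y * X 0
  Y_sq : (Y : S) * Y = p.q1 • (Y : S) + algebraMap R S (p.q0 : R)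
  Y_X_Y_e : 0 < N → (Y : S) * X 0 * Y * cupCap p.toParamsA (X 0) = cupCap p.toParamsA (X 0)
  Y_comm : ∀ i, 0 < i → i < N → Y * X i = X i * Y

/-- The elements that map a submodule into itself by left multiplication. -/
def leftStab {R S : Type*} [CommRing R] [Ring S] [Algebra R S] (N : Submodule R S) :
    Subalgebra R S where
  carrier := {a | ∀ b ∈ N, a * b ∈ N}
  mul_mem' := fun {a b} ha hb c hc => by rw [mul_assoc]; exact ha _ (hb _ hc)
  add_mem' := fun {a b} ha hb c hc => by rw [add_mul]; exact N.add_mem (ha _ hc) (hb _ hc)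
  algebraMap_mem' := fun r c hc => by
    rw [← Algebra.smul_def]; exact N.smul_mem _ hc

/-- The criterion behind the spanning results: a submodule that contains `1` and is preserved by the
generators from the left contains the whole subalgebra. -/
theorem le_of_le_leftStab {R S : Type*} [CommRing R] [Ring S] [Algebra R S] {N : Submodule R S}
    {T : Subalgebra R S} (h : T ≤ leftStab N) (h1 : (1 : S) ∈ N) :
    Subalgebra.toSubmodule T ≤ N := fun a ha => by
  simpa using h ha 1 h1

theorem mem_leftStab_span {R S : Type*} [CommRing R] [Ring S] [Algebra R S] {s : Set S}
    {a : S} (h : ∀ b ∈ s, a * b ∈ Submodule.span R s) : a ∈ leftStab (Submodule.span R s) := by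
  intro b hb
  induction hb using Submodule.span_induction with
  | mem b hb => exact h b hb
  | zero => simp
  | add b c _ _ hb hc => rw [mul_add]; exact Submodule.add_mem _ hb hc
  | smul r b _ hb => rw [mul_smul_comm]; exact Submodule.smul_mem _ _ hb

namespace TypeBRep

variable {R : Type*} [CommRing R] {p : ParamsB R} {S : Type*} [Ring S] [Algebra R S] {N : ℕ}
variable (T : TypeBRep p S N)

/-- The element `e i` attached to `X i`. -/
def e (i : ℕ) : S := cupCap p.toParamsA (T.X i)

/-- The Jucys-Murphy elements. -/
def J : ℕ → Sˣ
  | 0 => T.Y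
  | k + 1 => T.X k * J k * T.X k

theorem J_succ (k : ℕ) : T.J (k + 1) = T.X k * T.J k * T.X k := rfl

/-- The subalgebra generated by the type A generators on the first `k` strands. -/
def algA (k : ℕ) : Subalgebra R S :=
  Algebra.adjoin R {g | ∃ l, l + 1 < k ∧ g = (T.X l : S)}

/-- The subalgebra generated by the type B generators on the first `k` strands. -/
def algB (k : ℕ) : Subalgebra R S :=
  Algebra.adjoin R ({g | 0 < k ∧ g = (T.Y : S)} ∪ {g | ∃ l, l + 1 < k ∧ g = (T.X l : S)})

theorem algA_le_algB (k : ℕ) : T.algA k ≤ T.algB k :=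
  Algebra.adjoin_mono Set.subset_union_right

theorem algA_mono {k l : ℕ} (h : k ≤ l) : T.algA k ≤ T.algA l := by
  refine Algebra.adjoin_mono ?_
  rintro g ⟨i, hi, rfl⟩
  exact ⟨i, by omega, rfl⟩

theorem algB_le_iff {k : ℕ} {A : Subalgebra R S} : T.algB k ≤ A ↔
    (0 < k → (T.Y : S) ∈ A) ∧ ∀ l, l + 1 < k → (T.X l : S) ∈ A := by
  rw [algB, Algebra.adjoin_le_iff]
  constructor
  · exact fun h => ⟨fun hk => h (Or.inl ⟨hk, rfl⟩), fun l hl => h (Or.inr ⟨l, hl, rfl⟩)⟩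
  · rintro ⟨h1, h2⟩ g (⟨hk, rfl⟩ | ⟨l, hl, rfl⟩)
    exacts [h1 hk, h2 l hl]

theorem Y_mem {k : ℕ} (hk : 0 < k) : (T.Y : S) ∈ T.algB k :=
  (T.algB_le_iff.1 le_rfl).1 hk

theorem X_mem_algA {k l : ℕ} (hl : l + 1 < k) : (T.X l : S) ∈ T.algA k :=
  Algebra.subset_adjoin ⟨l, hl, rfl⟩

theorem X_mem {k l : ℕ} (hl : l + 1 < k) : (T.X l : S) ∈ T.algB k :=
  T.algA_le_algB k (T.X_mem_algA hl)

theorem algB_mono {k l : ℕ} (h : k ≤ l) : T.algB k ≤ T.algB l :=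
  T.algB_le_iff.2 ⟨fun _ => T.Y_mem (by omega), fun _ _ => T.X_mem (by omega)⟩

theorem X_inv_mem_algA {k l : ℕ} (hN : l < N) (hl : l + 1 < k) :
    (((T.X l)⁻¹ : Sˣ) : S) ∈ T.algA k :=
  (T.kauffman l hN).inv_mem (T.X_mem_algA hl)

theorem X_inv_mem {k l : ℕ} (hN : l < N) (hl : l + 1 < k) :
    (((T.X l)⁻¹ : Sˣ) : S) ∈ T.algB k :=
  T.algA_le_algB k (T.X_inv_mem_algA hN hl)

theorem e_mem_algA {k l : ℕ} (hN : l < N) (hl : l + 1 < k) : T.e l ∈ T.algA k :=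
  cupCap_mem _ (T.X_mem_algA hl) (T.X_inv_mem_algA hN hl)

theorem e_mem {k l : ℕ} (hN : l < N) (hl : l + 1 < k) : T.e l ∈ T.algB k :=
  T.algA_le_algB k (T.e_mem_algA hN hl)

theorem Y_inv : ((T.Y⁻¹ : Sˣ) : S) =
    ((p.q0⁻¹ : Rˣ) : R) • ((T.Y : S) - p.q1 • (1 : S)) := by
  rw [Units.inv_eq_of_mul_eq_one_right]
  rw [mul_smul_comm, mul_sub, T.Y_sq]
  simp [Algebra.algebraMap_eq_smul_one, smul_smul]

theorem Y_eq : (T.Y : S) =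
    (p.q0 : R) • ((T.Y⁻¹ : Sˣ) : S) + p.q1 • (1 : S) := by
  rw [T.Y_inv, smul_smul]; simp

theorem Y_inv_mem {k : ℕ} (hk : 0 < k) : ((T.Y⁻¹ : Sˣ) : S) ∈ T.algB k := by
  rw [T.Y_inv]
  exact (T.algB k).smul_mem ((T.algB k).sub_mem (T.Y_mem hk)
    ((T.algB k).smul_mem (T.algB k).one_mem _)) _

theorem J_mem {k l : ℕ} (h : k < l) : (T.J k : S) ∈ T.algB l := by
  induction k with
  | zero => exact T.Y_mem h
  | succ k ih =>
    have hX := T.X_mem (k := l) (l := k) (by omega)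
    rw [J_succ, Units.val_mul, Units.val_mul]
    exact mul_mem (mul_mem hX (ih (by omega))) hX

theorem J_inv_mem {k l : ℕ} (hN : k ≤ N) (h : k < l) : (((T.J k)⁻¹ : Sˣ) : S) ∈ T.algB l := by
  induction k with
  | zero => exact T.Y_inv_mem h
  | succ k ih =>
    have hX := T.X_inv_mem (k := l) (l := k) (by omega) (by omega)
    rw [J_succ, mul_inv_rev, mul_inv_rev, Units.val_mul, Units.val_mul]
    exact mul_mem hX (mul_mem (ih (by omega) (by omega)) hX)

theorem commute_of_mem_algB {a b : S} {k : ℕ} (hY : 0 < k → Commute a T.Y)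
    (hX : ∀ l, l + 1 < k → Commute a (T.X l)) (hb : b ∈ T.algB k) : Commute a b := by
  have h : T.algB k ≤ Subalgebra.centralizer R {a} := by
    rw [algB_le_iff]
    simp only [Subalgebra.mem_centralizer_iff, Set.mem_singleton_iff, forall_eq]
    exact ⟨fun hk => (hY hk).eq, fun l hl => (hX l hl).eq⟩
  exact (Subalgebra.mem_centralizer_iff R).1 (h hb) a rfl

theorem commute_X_X {i j : ℕ} (hj : j < N) (h : i + 1 < j) : Commute (T.X i) (T.X j) :=
  T.comm i j h hj

theorem commute_X_algB {l k : ℕ} (hl : l < N) (hk : k ≤ l) {b : S} (hb : b ∈ T.algB k) :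
    Commute (T.X l : S) b := by
  refine T.commute_of_mem_algB (fun h => ?_) (fun i hi => ?_) hb
  · exact Commute.units_val (T.Y_comm l (by omega) hl).symm
  · exact Commute.units_val (T.comm i l (by omega) hl).symm

theorem commute_X_inv_algB {l k : ℕ} (hl : l < N) (hk : k ≤ l) {b : S} (hb : b ∈ T.algB k) :
    Commute (((T.X l)⁻¹ : Sˣ) : S) b :=
  (T.commute_X_algB hl hk hb).units_inv_left

theorem commute_e_algB {l k : ℕ} (hl : l < N) (hk : k ≤ l) {b : S} (hb : b ∈ T.algB k) :
    Commute (T.e l) b :=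
  (commute_cupCap _ (T.commute_X_algB hl hk hb).symm).symm

theorem commute_J_X_of_lt {k l : ℕ} (hl : l < N) (h : k < l) : Commute (T.J k) (T.X l) := by
  have := (T.commute_X_algB hl le_rfl (T.J_mem h)).symm
  exact this.units_of_val

theorem commute_J_Y {k : ℕ} (hk : k ≤ N) : Commute (T.J k) T.Y := by
  induction k with
  | zero => exact Commute.refl _
  | succ k ih =>
    rcases k with _ | k
    · have := T.X_Y_X_Y (by omega)
      show T.X 0 * T.Y * T.X 0 * T.Y = T.Y * (T.X 0 * T.Y * T.X 0)
      rw [this]; group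
    · have hX : Commute (T.X (k + 1)) T.Y := (T.Y_comm (k + 1) (by omega) (by omega)).symm
      exact (hX.mul_left (ih (by omega))).mul_left hX

/-- The essential case is `k = l + 2`: two braid moves carry `X l` through `J (l + 2)`, turning it
into `X (l + 1)` while it crosses `J l`. Larger `k` only add generators that commute with `X l`. -/
theorem commute_J_X_of_add_one_lt {k l : ℕ} (hk : k ≤ N) (h : l + 1 < k) :
    Commute (T.J k) (T.X l) := by
  induction k with
  | zero => omega
  | succ k ih =>
    rcases eq_or_ne k (l + 1) with rfl | hne
    · have hb := (T.pair l (by omega)).braid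
      have hc := T.commute_J_X_of_lt (k := l) (l := l + 1) (by omega) (by omega)
      have hc' : T.J l * T.X (l + 1) = T.X (l + 1) * T.J l := hc
      show T.X (l + 1) * (T.X l * T.J l * T.X l) * T.X (l + 1) * T.X l =
        T.X l * (T.X (l + 1) * (T.X l * T.J l * T.X l) * T.X (l + 1))
      calc _ = T.X (l + 1) * T.X l * T.J l * (T.X l * T.X (l + 1) * T.X l) := by group
        _ = T.X (l + 1) * T.X l * (T.J l * T.X (l + 1)) * T.X l * T.X (l + 1) := by
          rw [hb]; group
        _ = (T.X (l + 1) * T.X l * T.X (l + 1)) * T.J l * T.X l * T.X (l + 1) := by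
          rw [hc']; group
        _ = _ := by rw [← hb]; group
    · have hX : Commute (T.X k) (T.X l) := (T.commute_X_X (by omega) (by omega)).symm
      exact (hX.mul_left (ih (by omega) (by omega))).mul_left hX

theorem commute_J_algB {k l : ℕ} (hk : k ≤ N) (h : l ≤ k) {b : S} (hb : b ∈ T.algB l) :
    Commute (T.J k : S) b := by
  refine T.commute_of_mem_algB (fun _ => ?_) (fun i hi => ?_) hb
  · exact (T.commute_J_Y hk).units_val
  · exact (T.commute_J_X_of_add_one_lt hk (show i + 1 < k by omega)).units_val

theorem commute_J_J {k l : ℕ} (hk : k ≤ N) (hl : l ≤ N) : Commute (T.J k) (T.J l) := by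
  rcases lt_trichotomy k l with h | rfl | h
  · have := (T.commute_J_algB hl le_rfl (T.J_mem h)).symm
    exact this.units_of_val
  · exact Commute.refl _
  · have := T.commute_J_algB hk le_rfl (T.J_mem h)
    exact this.units_of_val

theorem X_mul_e {k : ℕ} (hk : k < N) : (T.X k : S) * T.e k = (p.lam : R) • T.e k :=
  (T.kauffman k hk).mul_cupCap

theorem e_mul_X {k : ℕ} (hk : k < N) : T.e k * T.X k = (p.lam : R) • T.e k :=
  (T.kauffman k hk).cupCap_mul

/-- On a cup, `J (k + 1)` acts as `lam` times the inverse of `J k`. The case `k = 0` is the relation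
`Y * X 0 * Y * e 0 = e 0`, and `X k * e (k + 1) = (X (k + 1))⁻¹ * e k * e (k + 1)` transports the
identity from `e k` to `e (k + 1)`. -/
theorem J_mul_J_mul_e {k : ℕ} (hk : k < N) :
    (T.J (k + 1) : S) * T.J k * T.e k = (p.lam : R) • T.e k := by
  induction k with
  | zero =>
    have := T.Y_X_Y_e hk
    rw [← T.X_mul_e hk]
    conv_rhs => rw [e, ← this]
    simp [J, e, mul_assoc]
  | succ k ih =>
    have hp := T.pair k hk
    have h1 : (T.X k : S) * T.e (k + 1) =
        (((T.X (k + 1))⁻¹ : Sˣ) : S) * T.e k * T.e (k + 1) := hp.symm.right_mul_cupCap_left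
    have h2 : (T.X k : S) * T.X (k + 1) * T.e k = T.e (k + 1) * T.e k := hp.mul_mul_cupCap
    have h3 : T.e (k + 1) * T.e k * T.e (k + 1) = T.e (k + 1) :=
      hp.symm.cupCap_mul_cupCap_mul_cupCap
    have c1 : (T.J (k + 2) : S) * T.X k = T.X k * T.J (k + 2) := by
      exact_mod_cast (T.commute_J_X_of_add_one_lt (k := k + 2) (l := k) (by omega) (by omega)).eq
    have c2 : (T.J k : S) * (((T.X (k + 1))⁻¹ : Sˣ) : S) =
        (((T.X (k + 1))⁻¹ : Sˣ) : S) * T.J k := by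
      exact_mod_cast (T.commute_J_X_of_lt (k := k) (l := k + 1) (by omega) (by omega)).inv_right.eq
    have c3 : (T.J (k + 2) : S) * (((T.X (k + 1))⁻¹ : Sˣ) : S) = T.X (k + 1) * T.J (k + 1) := by
      rw [J_succ T (k + 1)]; simp
    calc (T.J (k + 2) : S) * T.J (k + 1) * T.e (k + 1)
        = T.J (k + 2) * T.X k * T.J k * (T.X k * T.e (k + 1)) := by
          rw [J_succ T k]; simp [mul_assoc]
      _ = T.X k * T.J (k + 2) * (T.J k * (((T.X (k + 1))⁻¹ : Sˣ) : S)) * T.e k * T.e (k + 1) := by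
          rw [h1, c1]; simp [mul_assoc]
      _ = T.X k * (T.J (k + 2) * (((T.X (k + 1))⁻¹ : Sˣ) : S)) * T.J k * T.e k * T.e (k + 1) := by
          rw [c2]; simp [mul_assoc]
      _ = T.X k * T.X (k + 1) * (T.J (k + 1) * T.J k * T.e k) * T.e (k + 1) := by
          rw [c3]; simp [mul_assoc]
      _ = (p.lam : R) • (T.X k * T.X (k + 1) * T.e k * T.e (k + 1)) := by
          rw [ih (by omega)]; simp
      _ = _ := by rw [h2, h3]

theorem J_succ_mul_e {k : ℕ} (hk : k < N) :
    (T.J (k + 1) : S) * T.e k = (p.lam : R) • ((((T.J k)⁻¹ : Sˣ) : S) * T.e k) := by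
  have h := T.J_mul_J_mul_e hk
  have hc : (T.J (k + 1) : S) * T.J k = T.J k * T.J (k + 1) := by
    exact_mod_cast (T.commute_J_J (k := k + 1) (l := k) (by omega) (by omega)).eq
  rw [hc] at h
  rw [← mul_smul_comm, ← h]
  simp [mul_assoc]

theorem J_mul_e {k : ℕ} (hk : k < N) :
    (T.J k : S) * T.e k = (p.lam : R) • ((((T.J (k + 1))⁻¹ : Sˣ) : S) * T.e k) := by
  have h := T.J_mul_J_mul_e hk
  rw [← mul_smul_comm, ← h]
  simp [mul_assoc]

theorem J_succ_inv_mul_e {k : ℕ} (hk : k < N) :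
    (((T.J (k + 1))⁻¹ : Sˣ) : S) * T.e k = ((p.lam⁻¹ : Rˣ) : R) • ((T.J k : S) * T.e k) := by
  rw [T.J_mul_e hk, smul_smul]; simp

/-- As `J k` and `J (k + 1)` commute, their product commutes with `X k`. This converts identities at
a cup into identities at a cap. -/
theorem commute_J_mul_J_e {k : ℕ} (hk : k < N) :
    Commute ((T.J (k + 1) : S) * T.J k) (T.e k) := by
  have hc := (T.commute_J_J (k := k + 1) (l := k) (by omega) (by omega)).eq
  have h : Commute (T.J (k + 1) * T.J k) (T.X k) := by
    calc T.J (k + 1) * T.J k * T.X k = T.X k * (T.J k * T.J (k + 1)) := by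
          rw [J_succ]; group
      _ = _ := by rw [hc]
  exact commute_cupCap _ (by simpa using h.units_val)

theorem e_mul_J {k : ℕ} (hk : k < N) :
    T.e k * (T.J k : S) = (p.lam : R) • (T.e k * (((T.J (k + 1))⁻¹ : Sˣ) : S)) := by
  have h := T.J_mul_J_mul_e hk
  have hc : (T.J (k + 1) : S) * T.J k = T.J k * T.J (k + 1) := by
    exact_mod_cast (T.commute_J_J (k := k + 1) (l := k) (by omega) (by omega)).eq
  rw [(T.commute_J_mul_J_e hk).eq, hc] at h
  rw [← smul_mul_assoc, ← h]
  simp [mul_assoc]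

theorem e_mul_J_succ {k : ℕ} (hk : k < N) :
    T.e k * (T.J (k + 1) : S) = (p.lam : R) • (T.e k * (((T.J k)⁻¹ : Sˣ) : S)) := by
  have h := T.J_mul_J_mul_e hk
  rw [(T.commute_J_mul_J_e hk).eq] at h
  rw [← smul_mul_assoc, ← h]
  simp [mul_assoc]

theorem e_mul_J_succ_inv {k : ℕ} (hk : k < N) :
    T.e k * (((T.J (k + 1))⁻¹ : Sˣ) : S) = ((p.lam⁻¹ : Rˣ) : R) • (T.e k * (T.J k : S)) := by
  rw [T.e_mul_J hk, smul_smul]; simp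

end TypeBRep

end BMW

/-! ### Generation of the algebra on `k + 1` strands as a bimodule over the one on `k` strands. -/

namespace BMW

namespace TypeBRep

variable {R : Type*} [CommRing R] {p : ParamsB R} {S : Type*} [Ring S] [Algebra R S] {N : ℕ}
variable (T : TypeBRep p S N)

/-- The elements which, as a bimodule over the type B algebra on `k` strands, generate the one on
`k + 1` strands. -/
def bridge (k : ℕ) : Set S :=
  {g | g = 1 ∨ g = (((T.J k)⁻¹ : Sˣ) : S) ∨
    ∃ l, l + 1 = k ∧ (g = (((T.X l)⁻¹ : Sˣ) : S) ∨ g = T.e l)}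

/-- The bimodule generated by `bridge k`. -/
def bridgeSpan (k : ℕ) : Submodule R S :=
  Submodule.span R {w | ∃ b ∈ T.algB k, ∃ g ∈ T.bridge k, ∃ c ∈ T.algB k, w = b * g * c}

theorem mem_bridgeSpan {k : ℕ} {b g c : S} (hb : b ∈ T.algB k) (hg : g ∈ T.bridge k)
    (hc : c ∈ T.algB k) : b * g * c ∈ T.bridgeSpan k :=
  Submodule.subset_span ⟨b, hb, g, hg, c, hc, rfl⟩

theorem algB_le_leftStab_bridgeSpan (k : ℕ) : T.algB k ≤ leftStab (T.bridgeSpan k) := by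
  intro a ha
  refine mem_leftStab_span ?_
  rintro _ ⟨b, hb, g, hg, c, hc, rfl⟩
  rw [← mul_assoc, ← mul_assoc]
  exact T.mem_bridgeSpan (mul_mem ha hb) hg hc

theorem bridgeSpan_mul_mem {k : ℕ} {w a : S} (hw : w ∈ T.bridgeSpan k) (ha : a ∈ T.algB k) :
    w * a ∈ T.bridgeSpan k := by
  induction hw using Submodule.span_induction with
  | mem w hw =>
    obtain ⟨b, hb, g, hg, c, hc, rfl⟩ := hw
    rw [mul_assoc _ c]
    exact T.mem_bridgeSpan hb hg (mul_mem hc ha)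
  | zero => simp
  | add b c _ _ hb hc => rw [add_mul]; exact Submodule.add_mem _ hb hc
  | smul r b _ hb => rw [smul_mul_assoc]; exact Submodule.smul_mem _ _ hb

theorem algB_le_bridgeSpan {k : ℕ} {b : S} (hb : b ∈ T.algB k) : b ∈ T.bridgeSpan k := by
  simpa using T.mem_bridgeSpan hb (Or.inl rfl : (1 : S) ∈ T.bridge k) (one_mem _)

theorem J_inv_mem_bridgeSpan (k : ℕ) : (((T.J k)⁻¹ : Sˣ) : S) ∈ T.bridgeSpan k := by
  simpa using T.mem_bridgeSpan (one_mem _)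
    (Or.inr (Or.inl rfl) : (((T.J k)⁻¹ : Sˣ) : S) ∈ T.bridge k) (one_mem _)

theorem X_inv_mem_bridgeSpan (k : ℕ) : (((T.X k)⁻¹ : Sˣ) : S) ∈ T.bridgeSpan (k + 1) := by
  simpa using T.mem_bridgeSpan (one_mem _)
    (Or.inr (Or.inr ⟨k, rfl, Or.inl rfl⟩) : (((T.X k)⁻¹ : Sˣ) : S) ∈ T.bridge (k + 1)) (one_mem _)

theorem e_mem_bridgeSpan (k : ℕ) : T.e k ∈ T.bridgeSpan (k + 1) := by
  simpa using T.mem_bridgeSpan (one_mem _)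
    (Or.inr (Or.inr ⟨k, rfl, Or.inr rfl⟩) : T.e k ∈ T.bridge (k + 1)) (one_mem _)

theorem J_succ_inv (k : ℕ) : (((T.J (k + 1))⁻¹ : Sˣ) : S) =
    (((T.X k)⁻¹ : Sˣ) : S) * (((T.J k)⁻¹ : Sˣ) : S) * (((T.X k)⁻¹ : Sˣ) : S) := by
  simp [J_succ, mul_assoc]

theorem X_inv_mul_X_inv {k : ℕ} (hk : k < N) :
    (((T.X k)⁻¹ : Sˣ) : S) * (((T.X k)⁻¹ : Sˣ) : S) = 1 - (p.del : R) • (((T.X k)⁻¹ : Sˣ) : S)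
      + ((p.del : R) * ((p.lam⁻¹ : Rˣ) : R)) • T.e k :=
  (T.kauffman k hk).inv_mul_inv

theorem X_inv_mul_e {k : ℕ} (hk : k < N) :
    (((T.X k)⁻¹ : Sˣ) : S) * T.e k = ((p.lam⁻¹ : Rˣ) : R) • T.e k :=
  (T.kauffman k hk).inv_mul_cupCap

theorem e_mul_X_inv {k : ℕ} (hk : k < N) :
    T.e k * (((T.X k)⁻¹ : Sˣ) : S) = ((p.lam⁻¹ : Rˣ) : R) • T.e k :=
  (T.kauffman k hk).cupCap_mul_inv

theorem X_succ_inv_mul_e {k : ℕ} (hk : k + 1 < N) :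
    (((T.X (k + 1))⁻¹ : Sˣ) : S) * T.e k = T.X k * T.e (k + 1) * T.e k :=
  (T.pair k hk).right_inv_mul_cupCap_left

/-- Expanding `(J (k + 1))⁻¹` produces the square of `(X k)⁻¹`, which the skein relation reduces; in
the term with `e k`, the remaining factors collapse to `J k`. -/
theorem X_inv_mul_J_inv_mem {k : ℕ} (hk : k < N) :
    (((T.X k)⁻¹ : Sˣ) : S) * (((T.J (k + 1))⁻¹ : Sˣ) : S) ∈ T.bridgeSpan (k + 1) := by
  have hJ := T.J_inv_mem (k := k) (l := k + 1) (by omega) (by omega)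
  have h1 : T.e k * (((T.J k)⁻¹ : Sˣ) : S) * (((T.X k)⁻¹ : Sˣ) : S) = T.e k * T.J k := by
    have := T.e_mul_J_succ_inv hk
    rw [J_succ_inv, ← mul_assoc, ← mul_assoc, T.e_mul_X_inv hk, smul_mul_assoc,
      smul_mul_assoc] at this
    exact (p.lam⁻¹).isUnit.smul_left_cancel.1 this
  rw [J_succ_inv, ← mul_assoc, ← mul_assoc, T.X_inv_mul_X_inv hk, add_mul, add_mul, sub_mul,
    sub_mul, one_mul, smul_mul_assoc, smul_mul_assoc, smul_mul_assoc, smul_mul_assoc, h1,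
    ← J_succ_inv]
  refine Submodule.add_mem _ (Submodule.sub_mem _ ?_ (Submodule.smul_mem _ _ ?_))
    (Submodule.smul_mem _ _ ?_)
  · exact T.algB_le_leftStab_bridgeSpan _ hJ _ (T.X_inv_mem_bridgeSpan k)
  · exact T.J_inv_mem_bridgeSpan _
  · exact T.bridgeSpan_mul_mem (T.e_mem_bridgeSpan k) (T.J_mem (by omega))

theorem X_inv_mul_bridge_mul_X_inv_mem {k : ℕ} (hk : k < N) {g : S} (hg : g ∈ T.bridge k) :
    (((T.X k)⁻¹ : Sˣ) : S) * g * (((T.X k)⁻¹ : Sˣ) : S) ∈ T.bridgeSpan (k + 1) := by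
  rcases hg with rfl | rfl | ⟨l, rfl, rfl | rfl⟩
  · rw [mul_one, T.X_inv_mul_X_inv hk]
    exact Submodule.add_mem _ (Submodule.sub_mem _ (T.algB_le_bridgeSpan (one_mem _))
      (Submodule.smul_mem _ _ (T.X_inv_mem_bridgeSpan k)))
      (Submodule.smul_mem _ _ (T.e_mem_bridgeSpan k))
  · rw [← J_succ_inv]
    exact T.J_inv_mem_bridgeSpan _
  · have hb := congrArg (fun u : Sˣ => ((u⁻¹ : Sˣ) : S)) (T.pair l hk).braid
    simp only [mul_inv_rev, Units.val_mul, ← mul_assoc] at hb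
    rw [← hb]
    have hX := T.X_inv_mem (k := l + 2) (l := l) (by omega) (by omega)
    exact T.bridgeSpan_mul_mem (T.algB_le_leftStab_bridgeSpan _ hX _ (T.X_inv_mem_bridgeSpan _)) hX
  -- The left inverse is absorbed by creating `e (l + 1) * e l`; rewriting this product as `e (l +
  -- 1) * X l * X (l + 1)` cancels the right inverse.
  · have h1 : (((T.X (l + 1))⁻¹ : Sˣ) : S) * T.e l * (((T.X (l + 1))⁻¹ : Sˣ) : S) =
        T.X l * T.e (l + 1) * T.X l := by
      have := (T.pair l hk).mul_mul_cupCap_comm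
      have h2 := (T.pair l hk).mul_mul_cupCap
      have h3 := T.X_succ_inv_mul_e hk
      have h4 : T.e (l + 1) * T.e l = T.e (l + 1) * (T.X l * T.X (l + 1)) := h2.symm.trans this
      rw [h3, mul_assoc (T.X l : S), h4]
      simp [mul_assoc]
    rw [h1]
    have hX := T.X_mem (k := l + 2) (l := l) (by omega)
    exact T.bridgeSpan_mul_mem (T.algB_le_leftStab_bridgeSpan _ hX _ (T.e_mem_bridgeSpan _)) hX

theorem X_inv_mul_bridge_mul_e_mem {k : ℕ} (hk : k < N) {g : S} (hg : g ∈ T.bridge k) :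
    (((T.X k)⁻¹ : Sˣ) : S) * g * T.e k ∈ T.bridgeSpan (k + 1) := by
  rcases hg with rfl | rfl | ⟨l, rfl, rfl | rfl⟩
  · rw [mul_one, T.X_inv_mul_e hk]
    exact Submodule.smul_mem _ _ (T.e_mem_bridgeSpan k)
  · have h1 : (((T.X k)⁻¹ : Sˣ) : S) * (((T.J k)⁻¹ : Sˣ) : S) * T.e k = T.J k * T.e k := by
      have := T.J_succ_inv_mul_e hk
      rw [J_succ_inv, mul_assoc, T.X_inv_mul_e hk, mul_smul_comm] at this
      exact (p.lam⁻¹).isUnit.smul_left_cancel.1 this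
    rw [h1]
    exact T.algB_le_leftStab_bridgeSpan _ (T.J_mem (by omega)) _ (T.e_mem_bridgeSpan k)
  · have h1 : (((T.X (l + 1))⁻¹ : Sˣ) : S) * (((T.X l)⁻¹ : Sˣ) : S) * T.e (l + 1) =
        T.e l * T.e (l + 1) := (T.pair l hk).symm.inv_mul_inv_mul_cupCap
    rw [h1]
    exact T.algB_le_leftStab_bridgeSpan _ (T.e_mem (by omega) (by omega)) _ (T.e_mem_bridgeSpan _)
  · have h1 : T.e (l + 1) * T.e l * T.e (l + 1) = T.e (l + 1) :=
      (T.pair l hk).symm.cupCap_mul_cupCap_mul_cupCap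
    rw [T.X_succ_inv_mul_e hk, mul_assoc, mul_assoc, ← mul_assoc (T.e (l + 1)), h1]
    exact T.algB_le_leftStab_bridgeSpan _ (T.X_mem (by omega)) _ (T.e_mem_bridgeSpan _)

theorem algB_succ_le_bridgeSpan {k : ℕ} (hk : k ≤ N) :
    Subalgebra.toSubmodule (T.algB (k + 1)) ≤ T.bridgeSpan k := by
  induction k with
  | zero =>
    refine le_of_le_leftStab ?_ (T.algB_le_bridgeSpan (one_mem _))
    rw [algB_le_iff]
    refine ⟨fun _ => ?_, fun l hl => by omega⟩
    have h : ((T.Y⁻¹ : Sˣ) : S) ∈ leftStab (T.bridgeSpan 0) := by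
      refine mem_leftStab_span ?_
      rintro _ ⟨b, hb, g, hg, c, hc, rfl⟩
      have hcomm : ((T.Y⁻¹ : Sˣ) : S) * b = b * ((T.Y⁻¹ : Sˣ) : S) :=
        (T.commute_J_algB (k := 0) (by omega) le_rfl hb).units_inv_left.eq
      have h2 : ((T.Y⁻¹ : Sˣ) : S) * g ∈ T.bridgeSpan 0 := by
        rcases hg with rfl | rfl | ⟨l, hl, -⟩
        · rw [mul_one]; exact T.J_inv_mem_bridgeSpan 0
        · change ((T.Y⁻¹ : Sˣ) : S) * ((T.Y⁻¹ : Sˣ) : S) ∈ _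
          nth_rewrite 1 [T.Y_inv]
          rw [smul_mul_assoc, sub_mul, smul_mul_assoc, Units.mul_inv, one_mul]
          exact Submodule.smul_mem _ _ (Submodule.sub_mem _ (T.algB_le_bridgeSpan (one_mem _))
            (Submodule.smul_mem _ _ (T.J_inv_mem_bridgeSpan 0)))
        · omega
      rw [← mul_assoc, ← mul_assoc, hcomm, mul_assoc b]
      exact T.bridgeSpan_mul_mem (T.algB_le_leftStab_bridgeSpan 0 hb _ h2) hc
    rw [T.Y_eq]
    exact add_mem (Subalgebra.smul_mem _ h _) (Subalgebra.smul_mem _ (one_mem _) _)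
  | succ k ih =>
    refine le_of_le_leftStab ?_ (T.algB_le_bridgeSpan (one_mem _))
    rw [algB_le_iff]
    refine ⟨fun _ => T.algB_le_leftStab_bridgeSpan _ (T.Y_mem (by omega)), fun l hl => ?_⟩
    rcases eq_or_ne l k with rfl | hne
    swap
    · exact T.algB_le_leftStab_bridgeSpan _ (T.X_mem (by omega))
    -- The inverse generator is tested instead of `X l`, because it is the inverse that belongs to
    -- the bridge.
    refine (T.kauffman l (by omega)).mem_of_inv_mem (mem_leftStab_span ?_)
    rintro _ ⟨b, hb, g, hg, c, hc, rfl⟩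
    rw [← mul_assoc]
    refine T.bridgeSpan_mul_mem ?_ hc
    rw [← mul_assoc]
    -- Decompose `b` one level lower. Its outer factors commute with `X l` and with `g`, so only
    -- products `(X l)⁻¹ * g' * g` of bridge elements must be checked.
    have key : ∀ g : S, (∀ b ∈ T.algB l, Commute g b) →
        (∀ g' ∈ T.bridge l, (((T.X l)⁻¹ : Sˣ) : S) * g' * g ∈ T.bridgeSpan (l + 1)) →
        (((T.X l)⁻¹ : Sˣ) : S) * b * g ∈ T.bridgeSpan (l + 1) := by
      intro g hcomm hg'
      have hb' : b ∈ T.bridgeSpan l := ih (by omega) hb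
      clear hb
      induction hb' using Submodule.span_induction with
      | mem w hw =>
        obtain ⟨b, hb, g', hgm, c, hc, rfl⟩ := hw
        have hX := (T.commute_X_inv_algB (l := l) (by omega) le_rfl hb).eq
        have : (((T.X l)⁻¹ : Sˣ) : S) * (b * g' * c) * g =
            b * ((((T.X l)⁻¹ : Sˣ) : S) * g' * g) * c := by
          calc _ = (((T.X l)⁻¹ : Sˣ) : S) * b * g' * (c * g) := by simp only [mul_assoc]
            _ = _ := by rw [hX, ← (hcomm c hc).eq]; simp only [mul_assoc]
        rw [this]
        exact T.bridgeSpan_mul_mem (T.algB_le_leftStab_bridgeSpan _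
          (T.algB_mono (by omega) hb) _ (hg' g' hgm)) (T.algB_mono (by omega) hc)
      | zero => simp
      | add b c _ _ hb hc =>
        rw [mul_add, add_mul]; exact Submodule.add_mem _ hb hc
      | smul r b _ hb =>
        rw [mul_smul_comm, smul_mul_assoc]; exact Submodule.smul_mem _ _ hb
    rcases hg with rfl | rfl | ⟨l', hl', hg⟩
    · rw [mul_one]
      exact T.bridgeSpan_mul_mem (T.X_inv_mem_bridgeSpan l) hb
    · have hc := (T.commute_J_algB (k := l + 1) (by omega) le_rfl hb).units_inv_left.eq
      rw [mul_assoc, ← hc, ← mul_assoc]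
      exact T.bridgeSpan_mul_mem (T.X_inv_mul_J_inv_mem (by omega)) hb
    · obtain rfl : l' = l := by omega
      rcases hg with rfl | rfl
      · exact key _ (fun b hb => T.commute_X_inv_algB (by omega) le_rfl hb)
          fun g' hg' => T.X_inv_mul_bridge_mul_X_inv_mem (by omega) hg'
      · exact key _ (fun b hb => T.commute_e_algB (by omega) le_rfl hb)
          fun g' hg' => T.X_inv_mul_bridge_mul_e_mem (by omega) hg'

end TypeBRep

end BMW

/-! ### Peeling off the last top strand: strips, decorations and cup-cap chains. -/

namespace BMW

namespace TypeBRep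

variable {R : Type*} [CommRing R] {p : ParamsB R} {S : Type*} [Ring S] [Algebra R S] {N : ℕ}
variable (T : TypeBRep p S N)

/-- The product `X (k - 1) ^ ε (k - 1) * ⋯ * X j ^ ε j`. -/
def strip (ε : ℕ → ℤ) (j : ℕ) : ℕ → Sˣ
  | 0 => 1
  | k + 1 => if j ≤ k then T.X k ^ ε k * strip ε j k else 1

theorem strip_succ (ε : ℕ → ℤ) {j k : ℕ} (h : j ≤ k) :
    T.strip ε j (k + 1) = T.X k ^ ε k * T.strip ε j k := by
  simp [strip, h]

theorem strip_of_le (ε : ℕ → ℤ) {j k : ℕ} (h : k ≤ j) : T.strip ε j k = 1 := by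
  cases k with
  | zero => rfl
  | succ k => rw [strip, if_neg (by omega)]

theorem strip_eq_mul (ε : ℕ → ℤ) {j k : ℕ} (h : j < k) :
    T.strip ε j k = T.strip ε (j + 1) k * T.X j ^ ε j := by
  induction k with
  | zero => omega
  | succ k ih =>
    rcases eq_or_ne j k with rfl | hne
    · rw [strip_succ _ _ le_rfl, strip_of_le _ _ le_rfl, strip_of_le _ _ le_rfl]; simp
    · rw [strip_succ _ _ (by omega), strip_succ _ _ (by omega), ih (by omega), mul_assoc]

theorem X_zpow_mem_algA {k l : ℕ} (hN : l < N) (hl : l + 1 < k) (z : ℤ) :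
    ((T.X l ^ z : Sˣ) : S) ∈ T.algA k := by
  obtain ⟨n, rfl | rfl⟩ := z.eq_nat_or_neg
  · rw [zpow_natCast, Units.val_pow_eq_pow_val]
    exact pow_mem (T.X_mem_algA hl) n
  · rw [zpow_neg, zpow_natCast, ← inv_pow, Units.val_pow_eq_pow_val]
    exact pow_mem (T.X_inv_mem_algA hN hl) n

theorem strip_mem_algA (ε : ℕ → ℤ) (j : ℕ) {k l : ℕ} (hN : k ≤ N) (h : k < l) :
    (T.strip ε j k : S) ∈ T.algA l := by
  induction k with
  | zero => exact one_mem _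
  | succ k ih =>
    rw [strip]
    split_ifs
    · rw [Units.val_mul]
      exact mul_mem (T.X_zpow_mem_algA (by omega) (by omega) _) (ih (by omega) (by omega))
    · exact one_mem _

theorem strip_inv_mem_algA (ε : ℕ → ℤ) (j : ℕ) {k l : ℕ} (hN : k ≤ N) (h : k < l) :
    (((T.strip ε j k)⁻¹ : Sˣ) : S) ∈ T.algA l := by
  induction k with
  | zero => simp [strip]
  | succ k ih =>
    rw [strip]
    split_ifs
    · rw [mul_inv_rev, ← zpow_neg, Units.val_mul]
      exact mul_mem (ih (by omega) (by omega)) (T.X_zpow_mem_algA (by omega) (by omega) _)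
    · simp

/-- `up k j = X (k - 1)⁻¹ * ⋯ * (X j)⁻¹`. -/
def up (k j : ℕ) : Sˣ := T.strip (fun _ => -1) j k

/-- `down k j = X j * ⋯ * X (k - 1)`. -/
def down (k j : ℕ) : Sˣ := (T.up k j)⁻¹

theorem up_succ {j k : ℕ} (h : j ≤ k) : T.up (k + 1) j = (T.X k)⁻¹ * T.up k j := by
  rw [up, strip_succ _ _ h, zpow_neg_one, up]

theorem up_self (k : ℕ) : T.up k k = 1 := T.strip_of_le _ le_rfl

theorem down_self (k : ℕ) : T.down k k = 1 := by rw [down, up_self, inv_one]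

theorem down_succ {j k : ℕ} (h : j ≤ k) : T.down (k + 1) j = T.down k j * T.X k := by
  rw [down, up_succ _ h, mul_inv_rev, inv_inv, down]

theorem down_eq_mul {j k : ℕ} (h : j < k) : T.down k j = T.X j * T.down k (j + 1) := by
  rw [down, up, strip_eq_mul _ _ h, mul_inv_rev, zpow_neg_one, inv_inv]; rfl

theorem down_mem {k l : ℕ} (j : ℕ) (hN : k ≤ N) (h : k < l) : (T.down k j : S) ∈ T.algB l :=
  T.algA_le_algB _ (T.strip_inv_mem_algA _ _ hN h)

theorem commute_down {k j : ℕ} {a : Sˣ} (h : ∀ l, j ≤ l → l < k → Commute a (T.X l)) :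
    Commute a (T.down k j) := by
  induction k with
  | zero => simp [down, up, strip]
  | succ k ih =>
    rcases le_or_gt j k with hjk | hjk
    · rw [down_succ _ hjk]
      exact (ih fun l h1 h2 => h l h1 (by omega)).mul_right (h k hjk (by omega))
    · rw [down, up, strip_of_le _ _ hjk]; simp

/-- A crossing slides under the long strand of `down k j`; one braid relation does the work, and its
index drops because that strand is removed from its left. -/
theorem X_mul_down {k j l : ℕ} (hN : k ≤ N) (h1 : j ≤ l) (h2 : l + 1 < k) :
    T.X (l + 1) * T.down k j = T.down k j * T.X l := by
  induction k with
  | zero => omega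
  | succ k ih =>
    rw [down_succ _ (by omega)]
    rcases eq_or_ne k (l + 1) with rfl | hne
    · have hc : T.X (l + 1) * T.down l j = T.down l j * T.X (l + 1) :=
        (T.commute_down fun i hi hi' => (T.commute_X_X (by omega) (by omega)).symm).eq
      rw [down_succ _ h1]
      calc _ = (T.X (l + 1) * T.down l j) * T.X l * T.X (l + 1) := by group
        _ = T.down l j * (T.X (l + 1) * T.X l * T.X (l + 1)) := by rw [hc]; group
        _ = _ := by rw [← (T.pair l (by omega)).braid]; group
    · have hc : T.X l * T.X k = T.X k * T.X l := T.comm l k (by omega) (by omega)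
      rw [← mul_assoc, ih (by omega) (by omega), mul_assoc, hc, mul_assoc]

theorem e_mul_down {k j l : ℕ} (hN : k ≤ N) (h1 : j ≤ l) (h2 : l + 1 < k) :
    T.e (l + 1) * T.down k j = T.down k j * T.e l :=
  (cupCap_conj _ (by exact_mod_cast (T.X_mul_down hN h1 h2).symm)).symm

/-- The possible decorations of a strand that starts at the top in position `i`. -/
def dots (i : ℕ) : Set S := {z | z = 1 ∨ z = (T.J i : S)}

/-- The possible decorations of a strand that ends at the bottom in position `i`. -/
def dotsInv (i : ℕ) : Set S := {z | z = 1 ∨ z = (((T.J i)⁻¹ : Sˣ) : S)}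

theorem dots_mem {i k : ℕ} (h : i < k) {z : S} (hz : z ∈ T.dots i) : z ∈ T.algB k := by
  rcases hz with rfl | rfl
  exacts [one_mem _, T.J_mem h]

/-- The span of the products in which the last top strand is joined with a bottom strand
(first kind) or with another top strand (second kind). -/
def peelSpan (k : ℕ) : Submodule R S :=
  Submodule.span R {w | ∃ b ∈ T.algB k, (∃ j ≤ k, ∃ z ∈ T.dotsInv j, w = b * T.up k j * z) ∨
    ∃ l, l + 1 = k ∧ ∃ i ≤ l, ∃ z ∈ T.dots i, w = z * T.down l i * T.e l * b}

theorem mul_up_mem_peelSpan {k j : ℕ} {b z : S} (hb : b ∈ T.algB k) (hj : j ≤ k)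
    (hz : z ∈ T.dotsInv j) : b * T.up k j * z ∈ T.peelSpan k :=
  Submodule.subset_span ⟨b, hb, Or.inl ⟨j, hj, z, hz, rfl⟩⟩

theorem down_mul_mem_peelSpan {l i : ℕ} {b z : S} (hb : b ∈ T.algB (l + 1)) (hi : i ≤ l)
    (hz : z ∈ T.dots i) : z * T.down l i * T.e l * b ∈ T.peelSpan (l + 1) :=
  Submodule.subset_span ⟨b, hb, Or.inr ⟨l, rfl, i, hi, z, hz, rfl⟩⟩

theorem algB_le_peelSpan {k : ℕ} {b : S} (hb : b ∈ T.algB k) : b ∈ T.peelSpan k := by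
  simpa [up_self] using T.mul_up_mem_peelSpan hb le_rfl (Or.inl rfl)

theorem mul_J_inv_mem_peelSpan {k : ℕ} {b : S} (hb : b ∈ T.algB k) :
    b * (((T.J k)⁻¹ : Sˣ) : S) ∈ T.peelSpan k := by
  simpa [up_self] using T.mul_up_mem_peelSpan hb le_rfl (Or.inr rfl)

theorem e_mul_mem_peelSpan {k : ℕ} {b : S} (hb : b ∈ T.algB (k + 1)) :
    T.e k * b ∈ T.peelSpan (k + 1) := by
  simpa [down_self] using T.down_mul_mem_peelSpan hb le_rfl (Or.inl rfl)

theorem X_inv_mul_up {k j : ℕ} (hk : k < N) (hj : j ≤ k) {b z : S} (hb : b ∈ T.algB k) :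
    (((T.X k)⁻¹ : Sˣ) : S) * (b * T.up k j * z) = b * T.up (k + 1) j * z := by
  have hc := (T.commute_X_inv_algB hk le_rfl hb).eq
  rw [up_succ _ hj, Units.val_mul, ← mul_assoc, ← mul_assoc, hc]
  simp only [mul_assoc]

/-- `(X (k + 1))⁻¹ * e k = X k * e (k + 1) * e k` stretches the cup by one position, giving again a
word of the second kind. -/
theorem X_inv_mul_down {k i : ℕ} (hk : k + 1 < N) (hi : i ≤ k) {b z : S} (hz : z ∈ T.dots i) :
    (((T.X (k + 1))⁻¹ : Sˣ) : S) * (z * T.down k i * T.e k * b) =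
      z * T.down (k + 1) i * T.e (k + 1) * (T.e k * b) := by
  have hc := (T.commute_X_inv_algB (l := k + 1) (by omega) le_rfl
    (mul_mem (T.dots_mem (k := k + 1) (by omega) hz)
      (T.down_mem i (k := k) (by omega) (by omega)))).eq
  have h1 := T.X_succ_inv_mul_e hk
  calc _ = (((T.X (k + 1))⁻¹ : Sˣ) : S) * (z * T.down k i) * T.e k * b := by
        simp only [mul_assoc]
    _ = z * T.down k i * ((((T.X (k + 1))⁻¹ : Sˣ) : S) * T.e k) * b := by
        rw [hc]; simp only [mul_assoc]
    _ = _ := by rw [h1, down_succ _ hi, Units.val_mul]; simp only [mul_assoc]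

theorem X_inv_mul_mem_peelSpan {k : ℕ} (hk : k < N)
    (ih : Subalgebra.toSubmodule (T.algB (k + 1)) ≤ T.peelSpan k) {b : S}
    (hb : b ∈ T.algB (k + 1)) : (((T.X k)⁻¹ : Sˣ) : S) * b ∈ T.peelSpan (k + 1) := by
  have hb' : b ∈ T.peelSpan k := ih hb
  clear hb
  induction hb' using Submodule.span_induction with
  | mem w hw =>
    obtain ⟨b, hb, ⟨j, hj, z, hz, rfl⟩ | ⟨l, rfl, i, hi, z, hz, rfl⟩⟩ := hw
    · rw [T.X_inv_mul_up hk hj hb]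
      exact T.mul_up_mem_peelSpan (T.algB_mono (by omega) hb) (by omega) hz
    · rw [T.X_inv_mul_down hk hi hz]
      exact T.down_mul_mem_peelSpan (mul_mem (T.e_mem (by omega) (by omega))
        (T.algB_mono (by omega) hb)) (by omega) hz
  | zero => simp
  | add b c _ _ hb hc => rw [mul_add]; exact Submodule.add_mem _ hb hc
  | smul r b _ hb => rw [mul_smul_comm]; exact Submodule.smul_mem _ _ hb

/-- `chain s d = e s * e (s + 1) * ⋯ * e (s + d - 1)`. -/
def chain (s : ℕ) : ℕ → S
  | 0 => 1
  | d + 1 => T.e s * chain (s + 1) d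

theorem chain_succ (s d : ℕ) : T.chain s (d + 1) = T.e s * T.chain (s + 1) d := rfl

theorem chain_mem {s d k : ℕ} (hN : s + d ≤ N) (hk : s + d < k) : T.chain s d ∈ T.algB k := by
  induction d generalizing s with
  | zero => exact one_mem _
  | succ d ih =>
    exact mul_mem (T.e_mem (by omega) (by omega)) (ih (by omega) (by omega))

theorem chain_succ_right (s d : ℕ) : T.chain s (d + 1) = T.chain s d * T.e (s + d) := by
  induction d generalizing s with
  | zero => simp [chain]
  | succ d ih =>
    rw [chain, ih, chain, mul_assoc, show s + 1 + d = s + (d + 1) by omega]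

/-- The curls cancel and the decoration survives: it is inverted at the first `e m`, inverted back
at the second, and reaches position `m + 2`, where it commutes with `e m`. -/
theorem e_mul_dots_mul_X_mul_X_mul_e {m : ℕ} (hm : m + 1 < N) {z : S} (hz : z ∈ T.dots m) :
    ∃ z' ∈ T.dots (m + 2), T.e m * z * T.X m * T.X (m + 1) * T.e m = z' * T.e m := by
  have hd : T.e m * T.X (m + 1) * T.e m = ((p.lam⁻¹ : Rˣ) : R) • T.e m :=
    (T.pair m hm).symm.deloop
  have hd' : T.e m * (((T.X (m + 1))⁻¹ : Sˣ) : S) * T.e m = (p.lam : R) • T.e m :=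
    (T.pair m hm).symm.deloop_inv
  rcases hz with rfl | rfl
  · refine ⟨1, Or.inl rfl, ?_⟩
    rw [mul_one, T.e_mul_X (by omega), smul_mul_assoc, smul_mul_assoc, hd, smul_smul]
    simp
  · refine ⟨_, Or.inr rfl, ?_⟩
    have h1 : T.e m * (T.J m : S) * T.X m = T.e m * (((T.J m)⁻¹ : Sˣ) : S) := by
      have := T.e_mul_J_succ (k := m) (by omega)
      rw [J_succ, Units.val_mul, Units.val_mul, ← mul_assoc, ← mul_assoc, T.e_mul_X (by omega),
        smul_mul_assoc, smul_mul_assoc] at this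
      exact p.lam.isUnit.smul_left_cancel.1 this
    have h2 : (((T.J m)⁻¹ : Sˣ) : S) * T.e m =
        ((p.lam⁻¹ : Rˣ) : R) • ((T.J (m + 1) : S) * T.e m) := by
      rw [T.J_succ_mul_e (by omega), smul_smul]; simp
    have h3 : (((T.J m)⁻¹ : Sˣ) : S) * T.X (m + 1) = T.X (m + 1) * (((T.J m)⁻¹ : Sˣ) : S) :=
      (T.commute_J_X_of_lt (k := m) (l := m + 1) (by omega) (by omega)).units_val.units_inv_left.eq
    have h4 : (T.X (m + 1) : S) * T.J (m + 1) =
        T.J (m + 2) * (((T.X (m + 1))⁻¹ : Sˣ) : S) := by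
      rw [J_succ T (m + 1)]; simp
    have h5 : T.e m * T.J (m + 2) = T.J (m + 2) * T.e m :=
      (T.commute_J_algB (k := m + 2) (by omega) le_rfl (T.e_mem (by omega) (by omega))).symm.eq
    calc T.e m * T.J m * T.X m * T.X (m + 1) * T.e m
        = T.e m * ((((T.J m)⁻¹ : Sˣ) : S) * T.X (m + 1)) * T.e m := by
          rw [h1]; simp only [mul_assoc]
      _ = T.e m * T.X (m + 1) * ((((T.J m)⁻¹ : Sˣ) : S) * T.e m) := by
          rw [h3]; simp only [mul_assoc]
      _ = ((p.lam⁻¹ : Rˣ) : R) • (T.e m * (T.X (m + 1) * T.J (m + 1)) * T.e m) := by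
          rw [h2, mul_smul_comm]; simp only [mul_assoc]
      _ = ((p.lam⁻¹ : Rˣ) : R) • (T.J (m + 2) * (T.e m * (((T.X (m + 1))⁻¹ : Sˣ) : S) *
            T.e m)) := by
          rw [h4, ← mul_assoc, h5]; simp only [mul_assoc]
      _ = T.J (m + 2) * T.e m := by
          rw [hd', mul_smul_comm, smul_smul]; simp

/-- With a single crossing a decoration emerges inverted, hence in `dotsInv`: the result will be a
word of the first kind. -/
theorem e_mul_dots_mul_X_inv_mul_e {m : ℕ} (hm : m + 1 < N) {z : S} (hz : z ∈ T.dots m) :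
    ∃ r : R, ∃ z' ∈ T.dotsInv (m + 2),
      T.e m * z * (((T.X (m + 1))⁻¹ : Sˣ) : S) * T.e m = r • (z' * T.e m) := by
  rcases hz with rfl | rfl
  · refine ⟨p.lam, 1, Or.inl rfl, ?_⟩
    rw [mul_one, one_mul]
    exact (T.pair m hm).symm.deloop_inv
  · refine ⟨1, _, Or.inr rfl, ?_⟩
    have h1 : T.e m * (T.J m : S) * T.X m = ((p.lam⁻¹ : Rˣ) : R) • (T.e m * T.J (m + 1)) := by
      rw [J_succ, Units.val_mul, Units.val_mul, ← mul_assoc, ← mul_assoc, T.e_mul_X (by omega),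
        smul_mul_assoc, smul_mul_assoc, smul_smul]
      simp
    have h5 : T.e m * (((T.J (m + 2))⁻¹ : Sˣ) : S) = (((T.J (m + 2))⁻¹ : Sˣ) : S) * T.e m :=
      (T.commute_J_algB (k := m + 2) (by omega) le_rfl
        (T.e_mem (by omega) (by omega))).units_inv_left.symm.eq
    have h6 : T.e m * T.e (m + 1) * T.e m = T.e m := (T.pair m hm).cupCap_mul_cupCap_mul_cupCap
    calc T.e m * T.J m * (((T.X (m + 1))⁻¹ : Sˣ) : S) * T.e m
        = T.e m * T.J m * T.X m * T.e (m + 1) * T.e m := by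
          rw [mul_assoc _ _ (T.e m), T.X_succ_inv_mul_e hm]; simp only [mul_assoc]
      _ = ((p.lam⁻¹ : Rˣ) : R) • (T.e m * (T.J (m + 1) * T.e (m + 1)) * T.e m) := by
          rw [h1]; simp only [smul_mul_assoc, mul_assoc]
      _ = T.e m * (((T.J (m + 2))⁻¹ : Sˣ) : S) * T.e (m + 1) * T.e m := by
          rw [T.J_mul_e hm, mul_smul_comm, smul_mul_assoc, smul_smul]; simp [mul_assoc]
      _ = (1 : R) • ((((T.J (m + 2))⁻¹ : Sˣ) : S) * T.e m) := by
          rw [h5, mul_assoc, mul_assoc, ← mul_assoc (T.e m), h6, one_smul]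

end TypeBRep

end BMW

/-! ### Stability of the peeled words under left multiplication. -/

namespace BMW

namespace TypeBRep

variable {R : Type*} [CommRing R] {p : ParamsB R} {S : Type*} [Ring S] [Algebra R S] {N : ℕ}
variable (T : TypeBRep p S N)

theorem commute_algB_down {k j : ℕ} (hk : k ≤ N) {a : S} (ha : a ∈ T.algB j) :
    Commute a (T.down k j : S) := by
  induction k with
  | zero => simp [down, up, strip]
  | succ k ih =>
    rcases le_or_gt j k with hjk | hjk
    · rw [down_succ _ hjk, Units.val_mul]
      exact (ih (by omega)).mul_right (T.commute_X_algB (by omega) hjk ha).symm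
    · rw [down, up, strip_of_le _ _ hjk]; simp

theorem mul_dots_mul_down {k i : ℕ} (hk : k < N) (hi : i ≤ k) {a b z : S} (ha : a ∈ T.algB i)
    (hz : z ∈ T.dots i) :
    a * (z * T.down k i * T.e k * b) = z * T.down k i * T.e k * (a * b) := by
  have h1 : a * z = z * a := by
    rcases hz with rfl | rfl
    · simp
    · exact (T.commute_J_algB (by omega) le_rfl ha).symm.eq
  have h2 := (T.commute_algB_down hk.le ha).eq
  have h3 := (T.commute_e_algB hk hi ha).eq
  calc _ = a * z * T.down k i * T.e k * b := by simp only [mul_assoc]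
    _ = z * (a * T.down k i) * T.e k * b := by rw [h1]; simp only [mul_assoc]
    _ = z * T.down k i * (a * T.e k) * b := by rw [h2]; simp only [mul_assoc]
    _ = _ := by rw [← h3]; simp only [mul_assoc]

/-- Strand `i` leaves to form the cup, so the strands strictly between its ends move down by one
position. -/
theorem e_mul_dots_mul_down {k i m : ℕ} (hk : k < N) (hi : i ≤ m) (hm : m + 1 < k) {b z : S}
    (hz : z ∈ T.dots i) :
    T.e (m + 1) * (z * T.down k i * T.e k * b) = z * T.down k i * T.e k * (T.e m * b) := by
  have h1 := (T.commute_e_algB (l := m + 1) (by omega) le_rfl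
    (T.dots_mem (k := m + 1) (by omega) hz)).eq
  have h2 := T.e_mul_down hk.le hi hm
  have h3 := (T.commute_e_algB hk hm (T.e_mem (l := m) (by omega) (by omega))).eq
  calc _ = T.e (m + 1) * z * T.down k i * T.e k * b := by simp only [mul_assoc]
    _ = z * (T.e (m + 1) * T.down k i) * T.e k * b := by rw [h1]; simp only [mul_assoc]
    _ = z * T.down k i * (T.e m * T.e k) * b := by rw [h2]; simp only [mul_assoc]
    _ = _ := by rw [← h3]; simp only [mul_assoc]

theorem X_mul_dots_mul_down {k i m : ℕ} (hk : k < N) (hi : i ≤ m) (hm : m + 1 < k) {b z : S}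
    (hz : z ∈ T.dots i) :
    (T.X (m + 1) : S) * (z * T.down k i * T.e k * b) = z * T.down k i * T.e k * (T.X m * b) := by
  have h1 := (T.commute_X_algB (l := m + 1) (by omega) le_rfl
    (T.dots_mem (k := m + 1) (by omega) hz)).eq
  have h2 : (T.X (m + 1) : S) * T.down k i = T.down k i * T.X m := by
    exact_mod_cast T.X_mul_down hk.le hi hm
  have h3 := (T.commute_e_algB hk hm (T.X_mem (l := m) (by omega))).eq
  calc _ = T.X (m + 1) * z * T.down k i * T.e k * b := by simp only [mul_assoc]
    _ = z * (T.X (m + 1) * T.down k i) * T.e k * b := by rw [h1]; simp only [mul_assoc]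
    _ = z * T.down k i * (T.X m * T.e k) * b := by rw [h2]; simp only [mul_assoc]
    _ = _ := by rw [← h3]; simp only [mul_assoc]

theorem chain_mul_dots_mul_down {k i m d : ℕ} (hk : k < N) (hi : i ≤ m) (hd : m + d + 1 = k)
    {b z : S} (hz : z ∈ T.dots i) :
    T.chain (m + 1) d * (z * T.down k i * T.e k * (T.e (m + d) * b)) =
      z * T.down k i * T.e k * (T.chain m (d + 1) * b) := by
  induction d generalizing m with
  | zero => simp [chain]
  | succ d ih =>
    have h := ih (m := m + 1) (by omega) (by omega)
    rw [show m + 1 + d = m + (d + 1) by omega] at h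
    rw [chain, mul_assoc, h, T.e_mul_dots_mul_down hk hi (by omega) hz, T.chain_succ m,
      mul_assoc (T.e m)]

/-- The factors of the chain beyond `e i` pass through with a shift. Then `e i` meets the left end
of the cup and moves it to `i + 2`, after which the earlier factors commute past. -/
theorem chain_mul_X_inv_mul_down {l i : ℕ} (hl : l + 1 < N) (hi : i < l) {b z : S}
    (hb : b ∈ T.algB (l + 1)) (hz : z ∈ T.dots i) {s d : ℕ} (hs : s + d = l + 1) (hsi : s ≤ i) :
    ∃ z' ∈ T.dots (i + 2), ∃ c ∈ T.algB (l + 2),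
      T.chain s d * (z * T.down (l + 1) i * T.e (l + 1) * (T.e l * b)) =
        z' * T.down (l + 1) (i + 2) * T.e (l + 1) * c := by
  induction d generalizing s with
  | zero => omega
  | succ d ih =>
    rcases eq_or_lt_of_le hsi with rfl | hlt
    · have h1 := T.chain_mul_dots_mul_down (k := l + 1) (i := s) (m := s) (d := d) hl le_rfl
        (by omega) (b := b) hz
      obtain rfl : s + d = l := by omega
      obtain ⟨z', hz', h2⟩ := T.e_mul_dots_mul_X_mul_X_mul_e (m := s) (by omega) hz
      have hes := T.e_mem (l := s) (k := s + 2) (by omega) (by omega)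
      have h3 := (T.commute_algB_down (k := s + d + 1) (j := s + 2) (by omega) hes).eq
      have h4 := (T.commute_e_algB (l := s + d + 1) (k := s + 2) (by omega) (by omega) hes).eq
      refine ⟨z', hz', T.e s * (T.chain (s + 1) d * b), mul_mem (T.e_mem (by omega) (by omega))
        (mul_mem (T.chain_mem (by omega) (by omega)) (T.algB_mono (by omega) hb)), ?_⟩
      rw [chain, mul_assoc, h1, chain, down_eq_mul _ (show s < s + d + 1 by omega),
        down_eq_mul _ (show s + 1 < s + d + 1 by omega)]
      push_cast
      calc _ = T.e s * z * T.X s * T.X (s + 1) * T.down (s + d + 1) (s + 2) *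
              (T.e (s + d + 1) * T.e s) * (T.chain (s + 1) d * b) := by simp only [mul_assoc]
        _ = T.e s * z * T.X s * T.X (s + 1) * (T.down (s + d + 1) (s + 2) * T.e s) *
              T.e (s + d + 1) * (T.chain (s + 1) d * b) := by rw [h4]; simp only [mul_assoc]
        _ = (T.e s * z * T.X s * T.X (s + 1) * T.e s) * T.down (s + d + 1) (s + 2) *
              T.e (s + d + 1) * (T.chain (s + 1) d * b) := by rw [← h3]; simp only [mul_assoc]
        _ = z' * (T.e s * T.down (s + d + 1) (s + 2)) *
              T.e (s + d + 1) * (T.chain (s + 1) d * b) := by rw [h2]; simp only [mul_assoc]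
        _ = z' * T.down (s + d + 1) (s + 2) * (T.e s * T.e (s + d + 1)) *
              (T.chain (s + 1) d * b) := by rw [h3]; simp only [mul_assoc]
        _ = _ := by rw [← h4]; simp only [mul_assoc]
    · obtain ⟨z', hz', c, hc, h⟩ := ih (s := s + 1) (by omega) (by omega)
      refine ⟨z', hz', T.e s * c, mul_mem (T.e_mem (by omega) (by omega)) hc, ?_⟩
      rw [chain, mul_assoc, h, T.mul_dots_mul_down (by omega) (by omega)
        (T.e_mem (by omega) (by omega)) hz']

theorem algB_mul_X_inv_mul_up_mem {k j : ℕ} (hk : k < N) (hj : j ≤ k) {a b z : S}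
    (ha : a ∈ T.algB (k + 1)) (hb : b ∈ T.algB k) (hz : z ∈ T.dotsInv j) :
    a * ((((T.X k)⁻¹ : Sˣ) : S) * (b * T.up k j * z)) ∈ T.peelSpan (k + 1) := by
  rw [T.X_inv_mul_up hk hj hb, ← mul_assoc, ← mul_assoc]
  exact T.mul_up_mem_peelSpan (mul_mem ha (T.algB_mono (by omega) hb)) (by omega) hz

/-- After `b` is peeled, words of the first kind absorb the chain. For a cup starting at `i`, the
chain straightens it if `i = k - 1`, moves its start to `i + 2` if `s ≤ i < k - 1`, and otherwise
passes through it with a shift. -/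
theorem chain_mul_X_inv_mul_mem {k : ℕ} (hk : k < N)
    (ih : Subalgebra.toSubmodule (T.algB (k + 1)) ≤ T.peelSpan k) {b : S}
    (hb : b ∈ T.algB (k + 1)) {s d : ℕ} (hs : s + d = k) (hd : 0 < d) :
    T.chain s d * ((((T.X k)⁻¹ : Sˣ) : S) * b) ∈ T.peelSpan (k + 1) := by
  have hb' : b ∈ T.peelSpan k := ih hb
  clear hb
  induction hb' using Submodule.span_induction with
  | mem w hw =>
    obtain ⟨b, hb, ⟨j, hj, z, hz, rfl⟩ | ⟨l, rfl, i, hi, z, hz, rfl⟩⟩ := hw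
    · exact T.algB_mul_X_inv_mul_up_mem hk hj (T.chain_mem (by omega) (by omega)) hb hz
    · rcases eq_or_lt_of_le hi with rfl | hlt
      · obtain ⟨d, rfl⟩ : ∃ d', d = d' + 1 := ⟨d - 1, by omega⟩
        obtain rfl : s + d = i := by omega
        obtain ⟨r, z', hz', h⟩ := T.e_mul_dots_mul_X_inv_mul_e (by omega) hz
        have heb : T.e (s + d) * b ∈ T.algB (s + d + 2) :=
          mul_mem (T.e_mem (by omega) (by omega)) (T.algB_mono (by omega) hb)
        have hcomm : z' * (T.e (s + d) * b) = (T.e (s + d) * b) * z' := by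
          rcases hz' with rfl | rfl
          · simp
          · exact (T.commute_J_algB (k := s + d + 2) (by omega) le_rfl heb).units_inv_left.eq
        have : T.chain s (d + 1) * ((((T.X (s + d + 1))⁻¹ : Sˣ) : S) *
            (z * T.down (s + d) (s + d) * T.e (s + d) * b)) =
            r • ((T.chain s d * (T.e (s + d) * b)) * T.up (s + d + 2) (s + d + 2) * z') := by
          have hcz : (((T.X (s + d + 1))⁻¹ : Sˣ) : S) * z =
              z * (((T.X (s + d + 1))⁻¹ : Sˣ) : S) :=
            (T.commute_X_inv_algB (by omega) le_rfl (T.dots_mem (by omega) hz)).eq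
          calc _ = T.chain s d * (T.e (s + d) * ((((T.X (s + d + 1))⁻¹ : Sˣ) : S) * z) *
                  T.e (s + d)) * b := by
                rw [chain_succ_right, down_self, Units.val_one, mul_one]; simp only [mul_assoc]
            _ = T.chain s d * (T.e (s + d) * z * (((T.X (s + d + 1))⁻¹ : Sˣ) : S) *
                  T.e (s + d)) * b := by rw [hcz]; simp only [mul_assoc]
            _ = r • (T.chain s d * (z' * (T.e (s + d) * b))) := by
                rw [h]; simp only [mul_assoc, mul_smul_comm, smul_mul_assoc]
            _ = _ := by
                rw [hcomm, up_self, Units.val_one, mul_one]; simp only [mul_assoc]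
        rw [this]
        exact Submodule.smul_mem _ _ (T.mul_up_mem_peelSpan
          (mul_mem (T.chain_mem (by omega) (by omega)) heb) le_rfl hz')
      · rw [T.X_inv_mul_down hk hi hz]
        rcases le_or_gt s i with hsi | hsi
        · obtain ⟨z', hz', c, hc, h⟩ := T.chain_mul_X_inv_mul_down hk hlt hb hz hs hsi
          rw [h]
          exact T.down_mul_mem_peelSpan hc (by omega) hz'
        · obtain ⟨m, rfl⟩ : ∃ m, s = m + 1 := ⟨s - 1, by omega⟩
          obtain rfl : m + d = l := by omega
          rw [T.chain_mul_dots_mul_down hk (by omega) rfl hz]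
          exact T.down_mul_mem_peelSpan (mul_mem (T.chain_mem (by omega) (by omega))
            (T.algB_mono (by omega) hb)) (by omega) hz
  | zero => simp
  | add b c _ _ hb hc => rw [mul_add, mul_add]; exact Submodule.add_mem _ hb hc
  | smul r b _ hb => rw [mul_smul_comm, mul_smul_comm]; exact Submodule.smul_mem _ _ hb

/-- Each step uses `e s * X (s + 1) = e s * e (s + 1) * (X s)⁻¹`; the inverse commutes with the rest
of the strip and disappears into `b`. -/
theorem e_mul_down_mul_e {k s d : ℕ} (hk : k < N) (hs : s + d + 1 = k) {b : S}
    (hb : b ∈ T.algB (k + 1)) : ∃ c ∈ T.algB (k + 1),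
      T.e s * (T.down k (s + 1) * T.e k * b) =
        T.chain s (d + 1) * ((((T.X k)⁻¹ : Sˣ) : S) * c) := by
  induction d generalizing s b with
  | zero =>
    obtain rfl : s + 1 = k := by omega
    refine ⟨(((T.X s)⁻¹ : Sˣ) : S) * b, mul_mem (T.X_inv_mem (by omega) (by omega)) hb, ?_⟩
    have h : T.e s * ((((T.X (s + 1))⁻¹ : Sˣ) : S) * (((T.X s)⁻¹ : Sˣ) : S)) =
        T.e s * T.e (s + 1) := (T.pair s hk).symm.cupCap_mul_inv_mul_inv
    rw [down_self, Units.val_one, one_mul, ← mul_assoc, ← h]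
    simp [chain, mul_assoc]
  | succ d ih =>
    obtain ⟨c, hc, h⟩ := ih (s := s + 1) (by omega)
      (mul_mem (T.X_inv_mem (l := s) (by omega) (by omega)) hb)
    refine ⟨c, hc, ?_⟩
    have h1 : T.e s * T.X (s + 1) = T.e s * T.e (s + 1) * (((T.X s)⁻¹ : Sˣ) : S) :=
      (T.pair s (by omega)).symm.cupCap_right_mul_left
    have h2 := T.mul_dots_mul_down (k := k) (i := s + 2) (by omega) (by omega) (b := b)
      (T.X_inv_mem (l := s) (by omega) (by omega)) (Or.inl rfl)
    simp only [one_mul] at h2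
    rw [T.chain_succ s, mul_assoc (T.e s) (T.chain _ _), ← h,
      down_eq_mul _ (show s + 1 < k by omega), ← h2, Units.val_mul]
    calc _ = T.e s * T.X (s + 1) * (T.down k (s + 2) * T.e k * b) := by simp only [mul_assoc]
      _ = _ := by rw [h1]; simp only [mul_assoc]

/-- Only words of the second kind need work. A generator below their cup commutes past it, one
inside is shifted, and one at its left end moves that end or changes the decoration, up to the terms
treated in `key`. -/
theorem algB_le_leftStab_peelSpan {k : ℕ} (hk : k < N)
    (ih : Subalgebra.toSubmodule (T.algB (k + 1)) ≤ T.peelSpan k) :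
    T.algB (k + 1) ≤ leftStab (T.peelSpan (k + 1)) := by
  have key : ∀ s, s + 1 ≤ k → ∀ b ∈ T.algB (k + 1),
      T.e s * (T.down k (s + 1) * T.e k * b) ∈ T.peelSpan (k + 1) := by
    intro s hs b hb
    obtain ⟨d, hd⟩ : ∃ d, s + d + 1 = k := ⟨k - s - 1, by omega⟩
    obtain ⟨c, hc, h⟩ := T.e_mul_down_mul_e hk hd hb
    rw [h]
    exact T.chain_mul_X_inv_mul_mem hk ih hc (by omega) (by omega)
  have reduce : ∀ a ∈ T.algB (k + 1), (∀ i ≤ k, ∀ z ∈ T.dots i, ∀ b ∈ T.algB (k + 1),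
      a * (z * T.down k i * T.e k * b) ∈ T.peelSpan (k + 1)) →
      a ∈ leftStab (T.peelSpan (k + 1)) := by
    intro a ha h
    refine mem_leftStab_span ?_
    rintro _ ⟨b, hb, ⟨j, hj, z, hz, rfl⟩ | ⟨l, hl, i, hi, z, hz, rfl⟩⟩
    · rw [← mul_assoc, ← mul_assoc]
      exact T.mul_up_mem_peelSpan (mul_mem ha hb) hj hz
    · obtain rfl : l = k := by omega
      exact h i hi z hz b hb
  have mem0 : ∀ i ≤ k, ∀ b ∈ T.algB (k + 1),
      T.down k i * T.e k * b ∈ T.peelSpan (k + 1) := fun i hi b hb => by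
    simpa using T.down_mul_mem_peelSpan hb hi (Or.inl rfl)
  have mem1 : ∀ i ≤ k, ∀ b ∈ T.algB (k + 1),
      T.J i * T.down k i * T.e k * b ∈ T.peelSpan (k + 1) := fun i hi b hb =>
    T.down_mul_mem_peelSpan hb hi (Or.inr rfl)
  rw [algB_le_iff]
  refine ⟨fun _ => reduce _ (T.Y_mem (by omega)) ?_, fun m hm => reduce _ (T.X_mem hm) ?_⟩
  · intro i hi z hz b hb
    rcases Nat.eq_zero_or_pos i with rfl | hpos
    · rcases hz with rfl | rfl
      · rw [one_mul, ← mul_assoc, ← mul_assoc]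
        exact mem1 0 hi b hb
      · have : (T.Y : S) * (T.J 0 * T.down k 0 * T.e k * b) =
            p.q1 • (T.J 0 * T.down k 0 * T.e k * b) +
              (p.q0 : R) • (T.down k 0 * T.e k * b) := by
          change (T.Y : S) * (T.Y * T.down k 0 * T.e k * b) = p.q1 • (T.Y * T.down k 0 * T.e k * b)
            + _
          simp only [← mul_assoc]
          rw [T.Y_sq]
          simp [add_mul, Algebra.algebraMap_eq_smul_one]
        rw [this]
        exact Submodule.add_mem _ (Submodule.smul_mem _ _ (mem1 0 hi b hb))
          (Submodule.smul_mem _ _ (mem0 0 hi b hb))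
    · rw [T.mul_dots_mul_down hk hi (T.Y_mem hpos) hz]
      exact T.down_mul_mem_peelSpan (mul_mem (T.Y_mem (by omega)) hb) hi hz
  · intro i hi z hz b hb
    have hX : (T.X m : S) ∈ T.algB (k + 1) := T.X_mem hm
    rcases lt_or_ge (m + 1) i with h | h
    · rw [T.mul_dots_mul_down hk hi (T.X_mem h) hz]
      exact T.down_mul_mem_peelSpan (mul_mem hX hb) hi hz
    rcases eq_or_lt_of_le h with rfl | h
    · have hdown : (T.X m : S) * T.down k (m + 1) = T.down k m := by
        rw [down_eq_mul _ (show m < k by omega), Units.val_mul]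
      rcases hz with rfl | rfl
      · rw [one_mul, ← mul_assoc, ← mul_assoc, hdown]
        exact mem0 m (by omega) b hb
      · have hJm := T.J_inv_mem (k := m) (l := m + 1) (by omega) (by omega)
        have h1 := T.mul_dots_mul_down (b := b) hk hi hJm (Or.inl rfl)
        simp only [one_mul] at h1
        -- Only the inverse generator lowers the decoration, by `(X m)⁻¹ * J (m + 1) = J m * X m`.
        -- The correction with `e m` is covered by `key` once the decoration has become `(J m)⁻¹`.
        have hsk : (T.X m : S) = (((T.X m)⁻¹ : Sˣ) : S) + (p.del : R) • (1 : S) -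
            (p.del : R) • T.e m := by
          rw [coe_inv_eq_skein p.toParamsA (T.X m), e]; abel
        have h2 : (((T.X m)⁻¹ : Sˣ) : S) * T.J (m + 1) = T.J m * T.X m := by
          simp [J_succ, mul_assoc]
        have h3 := T.e_mul_J_succ (k := m) (by omega)
        have : (T.X m : S) * (T.J (m + 1) * T.down k (m + 1) * T.e k * b) =
            T.J m * T.down k m * T.e k * b +
              (p.del : R) • (T.J (m + 1) * T.down k (m + 1) * T.e k * b) -
              ((p.del : R) * (p.lam : R)) •
                (T.e m * (T.down k (m + 1) * T.e k * ((((T.J m)⁻¹ : Sˣ) : S) * b))) := by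
          rw [← h1, ← hdown]
          calc _ = ((T.X m : S) * T.J (m + 1)) * (T.down k (m + 1) * T.e k * b) := by
                simp only [mul_assoc]
            _ = (T.J m * T.X m + (p.del : R) • (T.J (m + 1) : S) - (p.del : R) • (p.lam : R) •
                  (T.e m * (((T.J m)⁻¹ : Sˣ) : S))) * (T.down k (m + 1) * T.e k * b) := by
                congr 1
                conv_lhs => enter [1]; rw [hsk]
                rw [sub_mul, add_mul, h2, smul_mul_assoc, one_mul, smul_mul_assoc, h3]
            _ = _ := by
                simp only [sub_mul, add_mul, smul_mul_assoc, smul_smul, mul_assoc]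
        rw [this]
        exact Submodule.sub_mem _ (Submodule.add_mem _ (mem1 m (by omega) b hb)
          (Submodule.smul_mem _ _ (mem1 _ hi b hb)))
          (Submodule.smul_mem _ _ (key m hi _ (mul_mem (T.algB_mono (by omega) hJm) hb)))
    · rcases eq_or_lt_of_le (show i ≤ m by omega) with rfl | him
      · rw [down_eq_mul _ (show i < k by omega), Units.val_mul]
        rcases hz with rfl | rfl
        · have h1 : (T.X i : S) * T.X i = 1 + (p.del : R) • (T.X i : S) -
            ((p.del : R) * (p.lam : R)) • T.e i := (T.kauffman i (by omega)).mul_self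
          have : (T.X i : S) * (1 * (T.X i * T.down k (i + 1)) * T.e k * b) =
              T.down k (i + 1) * T.e k * b + (p.del : R) • (T.down k i * T.e k * b) -
              ((p.del : R) * (p.lam : R)) • (T.e i * (T.down k (i + 1) * T.e k * b)) := by
            rw [one_mul, down_eq_mul _ (show i < k by omega), Units.val_mul]
            simp only [← mul_assoc]
            rw [h1]
            simp only [sub_mul, add_mul, smul_mul_assoc, one_mul]
          rw [this]
          exact Submodule.sub_mem _ (Submodule.add_mem _ (mem0 _ (by omega) b hb)
            (Submodule.smul_mem _ _ (mem0 _ hi b hb)))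
            (Submodule.smul_mem _ _ (key i (by omega) b hb))
        · have : (T.X i : S) * (T.J i * (T.X i * T.down k (i + 1)) * T.e k * b) =
              T.J (i + 1) * T.down k (i + 1) * T.e k * b := by
            simp [J_succ, mul_assoc]
          rw [this]
          exact mem1 _ (by omega) b hb
      · obtain ⟨m, rfl⟩ : ∃ m', m = m' + 1 := ⟨m - 1, by omega⟩
        rw [T.X_mul_dots_mul_down hk (by omega) (by omega) hz]
        exact T.down_mul_mem_peelSpan (mul_mem (T.X_mem (by omega)) hb) hi hz

theorem algB_succ_le_peelSpan {k : ℕ} (hk : k ≤ N) :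
    Subalgebra.toSubmodule (T.algB (k + 1)) ≤ T.peelSpan k := by
  induction k with
  | zero =>
    refine (T.algB_succ_le_bridgeSpan hk).trans (Submodule.span_le.2 ?_)
    rintro _ ⟨b, hb, g, hg, c, hc, rfl⟩
    rcases hg with rfl | rfl | ⟨l, hl, -⟩
    · rw [mul_one]; exact T.algB_le_peelSpan (mul_mem hb hc)
    · rw [mul_assoc, (T.commute_J_algB hk le_rfl hc).units_inv_left.eq, ← mul_assoc]
      exact T.mul_J_inv_mem_peelSpan (mul_mem hb hc)
    · omega
  | succ k ih =>
    have ih := ih (by omega)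
    have hstab := T.algB_le_leftStab_peelSpan (by omega) ih
    refine (T.algB_succ_le_bridgeSpan hk).trans (Submodule.span_le.2 ?_)
    rintro _ ⟨b, hb, g, hg, c, hc, rfl⟩
    rcases hg with rfl | rfl | ⟨l, hl, hg⟩
    · rw [mul_one]; exact T.algB_le_peelSpan (mul_mem hb hc)
    · rw [mul_assoc, (T.commute_J_algB hk le_rfl hc).units_inv_left.eq, ← mul_assoc]
      exact T.mul_J_inv_mem_peelSpan (mul_mem hb hc)
    · obtain rfl : l = k := by omega
      rw [mul_assoc]
      refine hstab hb _ ?_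
      rcases hg with rfl | rfl
      · exact T.X_inv_mul_mem_peelSpan (by omega) ih hc
      · exact T.e_mul_mem_peelSpan hc

end TypeBRep

end BMW

/-! ### Moving Jucys-Murphy elements outwards, and counting. -/

namespace BMW

namespace TypeBRep

variable {R : Type*} [CommRing R] {p : ParamsB R} {S : Type*} [Ring S] [Algebra R S] {N : ℕ}
variable (T : TypeBRep p S N)

theorem strip_congr {ε ε' : ℕ → ℤ} {j k : ℕ} (h : ∀ l, j ≤ l → l < k → ε l = ε' l) :
    T.strip ε j k = T.strip ε' j k := by
  induction k with
  | zero => rfl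
  | succ k ih =>
    rw [strip, strip, ih fun l h1 h2 => h l h1 (by omega)]
    split_ifs with hj
    · rw [h k hj (by omega)]
    · rfl

theorem commute_strip (ε : ℕ → ℤ) {k j : ℕ} {a : Sˣ}
    (h : ∀ l, j ≤ l → l < k → Commute a (T.X l)) : Commute a (T.strip ε j k) := by
  induction k with
  | zero => exact Commute.one_right _
  | succ k ih =>
    rw [strip]
    split_ifs with hj
    · exact ((h k hj (by omega)).zpow_right _).mul_right (ih fun l h1 h2 => h l h1 (by omega))
    · exact Commute.one_right _

/-- The order embedding of `ℕ` that omits `j`. -/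
def skip (j i : ℕ) : ℕ := if i < j then i else i + 1

theorem skip_injective (j : ℕ) : Function.Injective (skip j) := by
  intro a b h
  simp only [skip] at h
  split_ifs at h <;> omega

theorem skip_ne (j i : ℕ) : skip j i ≠ j := by
  simp only [skip]
  split_ifs <;> omega

theorem skip_lt {j i k : ℕ} (h : i < k) : skip j i < k + 1 := by
  simp only [skip]
  split_ifs <;> omega

/-- Below `j` nothing meets. Otherwise `(J i)⁻¹ * (X i)⁻¹ = X i * (J (i + 1))⁻¹` flips one exponent,
which is why strips carry variable exponents. -/
theorem J_inv_mul_strip {ε : ℕ → ℤ} {i j k : ℕ} (hk : k ≤ N) (hi : i < k) (hε : ε i = -1) :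
    (T.J i)⁻¹ * T.strip ε j k =
      T.strip (Function.update ε i 1) j k * (T.J (skip j i))⁻¹ := by
  rw [skip]
  split_ifs with hij
  · rw [T.strip_congr (ε := Function.update ε i 1) (ε' := ε) fun l h1 h2 =>
      Function.update_of_ne (by omega) _ _]
    exact (T.commute_strip ε fun l h1 h2 =>
      (T.commute_J_X_of_lt (by omega) (by omega)).inv_left).eq
  · induction k with
    | zero => omega
    | succ k ih =>
      rw [strip_succ _ _ (by omega), strip_succ _ _ (by omega)]
      rcases eq_or_ne i k with rfl | hne
      · have hc : (T.J (i + 1))⁻¹ * T.strip ε j i = T.strip ε j i * (T.J (i + 1))⁻¹ :=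
          (T.commute_strip ε fun l h1 h2 =>
            (T.commute_J_X_of_add_one_lt (by omega) (by omega)).inv_left).eq
        rw [T.strip_congr (ε := Function.update ε i 1) (ε' := ε) fun l h1 h2 =>
          Function.update_of_ne (by omega) _ _, mul_assoc _ (T.strip ε j i), ← hc, hε, J_succ]
        simp only [Function.update_self]
        group
      · have hc : (T.J i)⁻¹ * T.X k ^ ε k = T.X k ^ ε k * (T.J i)⁻¹ :=
          ((T.commute_J_X_of_lt (by omega) (by omega)).inv_left.zpow_right _).eq
        rw [← mul_assoc, hc, mul_assoc, ih (by omega) (by omega),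
          Function.update_of_ne (by omega), mul_assoc]

/-- Distinctness of the indices ensures that every factor still finds its own exponent equal to
`-1`. -/
theorem prod_J_inv_mul_strip {ε : ℕ → ℤ} {j k : ℕ} (hk : k ≤ N) {t : List ℕ} (ht : t.Nodup)
    (htk : ∀ i ∈ t, i < k) (hε : ∀ i ∈ t, ε i = -1) :
    ∃ ε' : ℕ → ℤ, (∀ i ∉ t, ε' i = ε i) ∧
      (t.map fun i => (T.J i)⁻¹).prod * T.strip ε j k =
        T.strip ε' j k * ((t.map (skip j)).map fun i => (T.J i)⁻¹).prod := by
  induction t with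
  | nil => exact ⟨ε, fun _ _ => rfl, by simp⟩
  | cons a t ih =>
    rw [List.nodup_cons] at ht
    simp only [List.mem_cons, forall_eq_or_imp] at htk hε
    obtain ⟨ε', h1, h2⟩ := ih ht.2 htk.2 hε.2
    refine ⟨Function.update ε' a 1, fun i hi => ?_, ?_⟩
    · rw [List.mem_cons, not_or] at hi
      rw [Function.update_of_ne hi.1, h1 i hi.2]
    · simp only [List.map_cons, List.prod_cons]
      rw [mul_assoc, h2, ← mul_assoc, T.J_inv_mul_strip hk htk.1 (by rw [h1 a ht.1, hε.1]),
        mul_assoc]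

theorem strip_inv_mul_prod_J {ε : ℕ → ℤ} {j k : ℕ} (hk : k ≤ N) {s : List ℕ} (hs : s.Nodup)
    (hsk : ∀ i ∈ s, i < k) (hε : ∀ i ∈ s, ε i = -1) :
    ∃ ε' : ℕ → ℤ, (T.strip ε j k)⁻¹ * (s.map T.J).prod =
        ((s.map (skip j)).map T.J).prod * (T.strip ε' j k)⁻¹ := by
  induction s generalizing ε with
  | nil => exact ⟨ε, by simp⟩
  | cons a s ih =>
    rw [List.nodup_cons] at hs
    simp only [List.mem_cons, forall_eq_or_imp] at hsk hε
    obtain ⟨ε', h2⟩ := ih (ε := Function.update ε a 1) hs.2 hsk.2 fun i hi => by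
      rw [Function.update_of_ne (ne_of_mem_of_not_mem hi hs.1), hε.2 i hi]
    refine ⟨ε', ?_⟩
    have h3 := congrArg (·⁻¹) (T.J_inv_mul_strip (j := j) hk hsk.1 hε.1)
    simp only [mul_inv_rev, inv_inv] at h3
    simp only [List.map_cons, List.prod_cons]
    rw [← mul_assoc, h3, mul_assoc, h2, mul_assoc]

/-- Products of distinct Jucys-Murphy elements, an element of type A, and inverses of distinct
Jucys-Murphy elements, with at most `k` Jucys-Murphy factors. -/
def nodupForms (k : ℕ) : Set S :=
  {w | ∃ s t : List ℕ, s.Nodup ∧ t.Nodup ∧ (∀ i ∈ s, i < k) ∧ (∀ i ∈ t, i < k) ∧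
    s.length + t.length ≤ k ∧ ∃ b ∈ T.algA k,
      w = ((s.map T.J).prod : Sˣ) * b * ((t.map fun i => (T.J i)⁻¹).prod : Sˣ)}

theorem prod_J_mem {k : ℕ} {s : List ℕ} (hs : ∀ i ∈ s, i < k) :
    (((s.map T.J).prod : Sˣ) : S) ∈ T.algB k := by
  induction s with
  | nil => exact one_mem _
  | cons a s ih =>
    simp only [List.mem_cons, forall_eq_or_imp] at hs
    rw [List.map_cons, List.prod_cons, Units.val_mul]
    exact mul_mem (T.J_mem hs.1) (ih hs.2)

theorem prod_J_inv_mem {k : ℕ} (hk : k ≤ N + 1) {s : List ℕ} (hs : ∀ i ∈ s, i < k) :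
    (((s.map fun i => (T.J i)⁻¹).prod : Sˣ) : S) ∈ T.algB k := by
  induction s with
  | nil => exact one_mem _
  | cons a s ih =>
    simp only [List.mem_cons, forall_eq_or_imp] at hs
    rw [List.map_cons, List.prod_cons, Units.val_mul]
    exact mul_mem (T.J_inv_mem (by omega) hs.1) (ih hs.2)

/-- The indices that have crossed the strip avoid `j`, so a new factor `(J j)⁻¹` keeps them
distinct. -/
theorem nodupForms_mul_up {k j : ℕ} (hk : k ≤ N) (hj : j ≤ k) {w z : S}
    (hw : w ∈ T.nodupForms k) (hz : z ∈ T.dotsInv j) :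
    w * T.up k j * z ∈ T.nodupForms (k + 1) := by
  obtain ⟨s, t, hs, ht, hsk, htk, hlen, b, hb, rfl⟩ := hw
  obtain ⟨ε', -, h⟩ := T.prod_J_inv_mul_strip (ε := fun _ => -1) (j := j) hk ht htk
    (fun _ _ => rfl)
  have hval := congrArg Units.val h
  rw [Units.val_mul, Units.val_mul] at hval
  obtain ⟨u, hu, hul, huk, hz'⟩ : ∃ u : List ℕ, (t.map (skip j) ++ u).Nodup ∧ u.length ≤ 1 ∧
      (∀ i ∈ u, i < k + 1) ∧ z = ((u.map fun i => (T.J i)⁻¹).prod : Sˣ) := by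
    rcases hz with rfl | rfl
    · exact ⟨[], by simpa using ht.map (skip_injective j), by simp, by simp, by simp⟩
    · refine ⟨[j], ?_, by simp, by simp; omega, by simp⟩
      rw [List.nodup_append]
      refine ⟨ht.map (skip_injective j), List.nodup_singleton j, ?_⟩
      intro a ha b hb
      obtain ⟨i, -, rfl⟩ := List.mem_map.1 ha
      rw [List.mem_singleton.1 hb]
      exact skip_ne j i
  refine ⟨s, t.map (skip j) ++ u, hs, hu, fun i hi => (hsk i hi).trans (by omega), ?_, ?_,
    b * T.strip ε' j k, mul_mem (T.algA_mono (by omega) hb) (T.strip_mem_algA _ _ hk (by omega)),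
    ?_⟩
  · intro i hi
    rcases List.mem_append.1 hi with hi | hi
    · obtain ⟨a, ha, rfl⟩ := List.mem_map.1 hi
      exact skip_lt (htk a ha)
    · exact huk i hi
  · simp only [List.length_append, List.length_map]; omega
  · rw [hz', List.map_append, List.prod_append, Units.val_mul, up, mul_assoc _ _
      (T.strip (fun _ => -1) j k : S), hval]
    simp only [mul_assoc]

/-- The only left factor that does not commute with `e l` is `J l`. It turns into a multiple of `(J
(l + 1))⁻¹`, which commutes with everything on `l + 1` strands and joins the right factors under an
unused index. -/
theorem down_mul_e_mul_nodupForms {l i : ℕ} (hl : l < N) (hi : i ≤ l) {w z : S}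
    (hw : w ∈ T.nodupForms (l + 1)) (hz : z ∈ T.dots i) :
    z * T.down l i * T.e l * w ∈ T.nodupForms (l + 2) := by
  obtain ⟨s, t, hs, ht, hsk, htk, hlen, b, hb, rfl⟩ := hw
  obtain ⟨s', u, hs', hu, hsk', huk, hlen', b', hb', h⟩ : ∃ s' u : List ℕ, s'.Nodup ∧
      (t ++ u).Nodup ∧ (∀ i ∈ s', i < l) ∧ (∀ i ∈ u, i < l + 2) ∧
      s'.length + u.length = s.length ∧ ∃ b' ∈ T.algA (l + 2),
      T.e l * (((s.map T.J).prod : Sˣ) * b * ((t.map fun i => (T.J i)⁻¹).prod : Sˣ)) =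
        ((s'.map T.J).prod : Sˣ) * b' * (((t ++ u).map fun i => (T.J i)⁻¹).prod : Sˣ) := by
    have he := T.e_mem_algA (l := l) (k := l + 2) hl (by omega)
    by_cases hmem : l ∈ s
    · have hsk' : ∀ i ∈ s.erase l, i < l := fun i hi => by
        have h1 := hsk i (List.mem_of_mem_erase hi)
        have h2 := (hs.mem_erase_iff.1 hi).1
        omega
      refine ⟨s.erase l, [l + 1], hs.erase l, ?_, hsk', by simp, ?_, (p.lam : R) • (T.e l * b),
        Subalgebra.smul_mem _ (mul_mem he (T.algA_mono (by omega) hb)) _, ?_⟩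
      · rw [List.nodup_append]
        refine ⟨ht, List.nodup_singleton _, fun a ha b hb => ?_⟩
        have := htk a ha
        rw [List.mem_singleton.1 hb]; omega
      · have := List.length_pos_of_mem hmem
        rw [List.length_erase_of_mem hmem, List.length_singleton]; omega
      · have hperm : (s.map T.J).prod = (s.erase l |>.map T.J).prod * T.J l := by
          have h1 : (s.map T.J).prod = ((l :: s.erase l).map T.J).prod := by
            refine ((List.perm_cons_erase hmem).map T.J).prod_eq' ?_
            rw [List.pairwise_map]
            refine List.Pairwise.imp_of_mem (R := fun _ _ => True) (fun ha hb _ => ?_)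
              (List.pairwise_iff_getElem.2 fun _ _ _ _ _ => trivial)
            exact T.commute_J_J (by have := hsk _ ha; omega) (by have := hsk _ hb; omega)
          rw [h1, List.map_cons, List.prod_cons]
          have := T.commute_J_algB (k := l) (by omega) le_rfl (T.prod_J_mem hsk')
          exact this.units_of_val.eq
        have hc := (T.commute_e_algB hl le_rfl (T.prod_J_mem hsk')).eq
        have hJ := T.e_mul_J hl
        have hbt : b * ((t.map fun i => (T.J i)⁻¹).prod : Sˣ) ∈ T.algB (l + 1) :=
          mul_mem (T.algA_le_algB _ hb) (T.prod_J_inv_mem (by omega) htk)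
        have hc2 := (T.commute_J_algB (k := l + 1) (by omega) le_rfl hbt).units_inv_left.eq
        rw [hperm, Units.val_mul, List.map_append, List.prod_append, Units.val_mul]
        simp only [List.map_cons, List.map_nil, List.prod_cons, List.prod_nil, mul_one]
        calc _ = (T.e l * ((s.erase l |>.map T.J).prod : Sˣ)) * T.J l *
                (b * ((t.map fun i => (T.J i)⁻¹).prod : Sˣ)) := by simp only [mul_assoc]
          _ = ((s.erase l |>.map T.J).prod : Sˣ) * (T.e l * T.J l) *
                (b * ((t.map fun i => (T.J i)⁻¹).prod : Sˣ)) := by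
              rw [hc]; simp only [mul_assoc]
          _ = (p.lam : R) • (((s.erase l |>.map T.J).prod : Sˣ) * T.e l *
                ((((T.J (l + 1))⁻¹ : Sˣ) : S) *
                  (b * ((t.map fun i => (T.J i)⁻¹).prod : Sˣ)))) := by
              rw [hJ]; simp only [mul_assoc, mul_smul_comm, smul_mul_assoc]
          _ = _ := by
              rw [hc2]; simp only [mul_assoc, mul_smul_comm, smul_mul_assoc]
    · have hsk' : ∀ i ∈ s, i < l := fun i hi => by
        have h1 := hsk i hi
        have h2 : i ≠ l := fun h => hmem (h ▸ hi)
        omega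
      refine ⟨s, [], hs, by simpa using ht, hsk', by simp, by simp, T.e l * b,
        mul_mem he (T.algA_mono (by omega) hb), ?_⟩
      have hc := (T.commute_e_algB hl le_rfl (T.prod_J_mem hsk')).eq
      rw [List.append_nil, ← mul_assoc, ← mul_assoc, hc]
      simp only [mul_assoc]
  obtain ⟨ε', h2⟩ := T.strip_inv_mul_prod_J (ε := fun _ => -1) (j := i) hl.le hs' hsk'
    (fun _ _ => rfl)
  have hval := congrArg Units.val h2
  rw [Units.val_mul, Units.val_mul] at hval
  obtain ⟨v, hv, hvl, hvk, hz'⟩ : ∃ v : List ℕ, (v ++ s'.map (skip i)).Nodup ∧ v.length ≤ 1 ∧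
      (∀ i ∈ v, i < l + 2) ∧ z = ((v.map T.J).prod : Sˣ) := by
    rcases hz with rfl | rfl
    · exact ⟨[], by simpa using hs'.map (skip_injective i), by simp, by simp, by simp⟩
    · refine ⟨[i], ?_, by simp, by simp; omega, by simp⟩
      rw [List.nodup_append]
      refine ⟨List.nodup_singleton i, hs'.map (skip_injective i), ?_⟩
      intro a ha b hb
      obtain ⟨c, -, rfl⟩ := List.mem_map.1 hb
      rw [List.mem_singleton.1 ha]
      exact (skip_ne i c).symm
  refine ⟨v ++ s'.map (skip i), t ++ u, hv, hu, ?_, ?_, ?_,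
    ((T.strip ε' i l)⁻¹ : Sˣ) * b', mul_mem (T.strip_inv_mem_algA _ _ hl.le (by omega)) hb', ?_⟩
  · intro c hc
    rcases List.mem_append.1 hc with hc | hc
    · exact hvk c hc
    · obtain ⟨a, ha, rfl⟩ := List.mem_map.1 hc
      have := skip_lt (j := i) (hsk' a ha)
      omega
  · intro c hc
    rcases List.mem_append.1 hc with hc | hc
    · have := htk c hc
      omega
    · exact huk c hc
  · simp only [List.length_append, List.length_map]; omega
  · rw [mul_assoc, h, hz', List.map_append (f := T.J), List.prod_append, Units.val_mul, down, up]
    calc _ = ((v.map T.J).prod : Sˣ) * ((((T.strip (fun _ => -1) i l)⁻¹ : Sˣ) : S) *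
          ((s'.map T.J).prod : Sˣ)) * b' * (((t ++ u).map fun i => (T.J i)⁻¹).prod : Sˣ) := by
          simp only [mul_assoc]
      _ = _ := by rw [hval]; simp only [mul_assoc]

-- Each spanning element on `k` strands produces `2 * (k + 1)` words of the first kind and `2 * k`
-- of the second.
open scoped Nat in
theorem exists_finset_nodupForms {k : ℕ} (hk : k ≤ N + 1) :
    ∃ F : Finset S, (F : Set S) ⊆ T.nodupForms k ∧ F.card ≤ 2 ^ k * (2 * k - 1)‼ ∧
      Subalgebra.toSubmodule (T.algB k) ≤ Submodule.span R (F : Set S) := by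
  classical
  induction k with
  | zero =>
    refine ⟨{1}, ?_, by simp, ?_⟩
    · rw [Finset.coe_singleton, Set.singleton_subset_iff]
      exact ⟨[], [], by simp, by simp, by simp, by simp, by simp, 1, one_mem _, by simp⟩
    · have h : T.algB 0 ≤ ⊥ := T.algB_le_iff.2 ⟨fun h => absurd h (by omega), fun l hl => by omega⟩
      intro a ha
      obtain ⟨r, rfl⟩ := Algebra.mem_bot.1 (h ha)
      rw [Algebra.algebraMap_eq_smul_one]
      exact Submodule.smul_mem _ _ (Submodule.subset_span (by simp))
  | succ k ih =>
    obtain ⟨F, hF, hcard, hspan⟩ := ih (by omega)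
    let F₁ : Finset S := (Finset.range (k + 1)).biUnion fun j =>
      (({1, (((T.J j)⁻¹ : Sˣ) : S)} : Finset S) ×ˢ F).image fun x => x.2 * T.up k j * x.1
    -- For `k = 0` the union is empty, so the truncated `k - 1` does no harm.
    let F₂ : Finset S := (Finset.range k).biUnion fun i =>
      (({1, (T.J i : S)} : Finset S) ×ˢ F).image fun x =>
        x.1 * T.down (k - 1) i * T.e (k - 1) * x.2
    have h2 : ∀ a b : S, ((({a, b} : Finset S) ×ˢ F)).card ≤ 2 * F.card := fun a b => by
      rw [Finset.card_product]
      exact Nat.mul_le_mul_right _ Finset.card_le_two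
    have hF₁ : F₁.card ≤ (k + 1) * (2 * F.card) := by
      simpa using Finset.card_biUnion_le_card_mul (Finset.range (k + 1)) _ (2 * F.card)
        fun j _ => Finset.card_image_le.trans (h2 _ _)
    have hF₂ : F₂.card ≤ k * (2 * F.card) := by
      simpa using Finset.card_biUnion_le_card_mul (Finset.range k) _ (2 * F.card)
        fun j _ => Finset.card_image_le.trans (h2 _ _)
    refine ⟨F₁ ∪ F₂, ?_, ?_, ?_⟩
    · intro w hw
      rcases Finset.mem_union.1 hw with hw | hw
      · obtain ⟨j, hj, hw⟩ := Finset.mem_biUnion.1 hw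
        obtain ⟨⟨z, w⟩, hx, rfl⟩ := Finset.mem_image.1 hw
        rw [Finset.mem_product] at hx
        have := Finset.mem_range.1 hj
        exact T.nodupForms_mul_up (by omega) (by omega) (hF hx.2)
          (by simpa [dotsInv] using hx.1)
      · obtain ⟨i, hi, hw⟩ := Finset.mem_biUnion.1 hw
        obtain ⟨⟨z, w⟩, hx, rfl⟩ := Finset.mem_image.1 hw
        rw [Finset.mem_product] at hx
        have := Finset.mem_range.1 hi
        obtain ⟨l, rfl⟩ : ∃ l, k = l + 1 := ⟨k - 1, by omega⟩
        exact T.down_mul_e_mul_nodupForms (by omega) (by omega) (hF hx.2)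
          (by simpa [dots] using hx.1)
    -- For `k = 0` the truncated value `2 * 0 - 1 = 0` still gives the right result, as `0‼ = 1`.
    · have hdf : (2 * (k + 1) - 1)‼ = (2 * k + 1) * (2 * k - 1)‼ := by
        rcases k with _ | k
        · simp
        · rw [show 2 * (k + 1 + 1) - 1 = (2 * k + 1) + 2 by omega, Nat.doubleFactorial_add_two,
            show 2 * (k + 1) - 1 = 2 * k + 1 by omega,
            show 2 * k + 1 + 2 = 2 * (k + 1) + 1 by omega]
      calc (F₁ ∪ F₂).card ≤ F₁.card + F₂.card := Finset.card_union_le _ _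
        _ ≤ 2 * (2 * k + 1) * F.card := by linarith
        _ ≤ 2 * (2 * k + 1) * (2 ^ k * (2 * k - 1)‼) := Nat.mul_le_mul_left _ hcard
        _ = _ := by rw [hdf]; ring
    · refine (T.algB_succ_le_peelSpan (by omega)).trans (Submodule.span_le.2 ?_)
      rintro _ ⟨b, hb, h⟩
      have hb' : b ∈ Submodule.span R (F : Set S) := hspan hb
      clear hb
      rcases h with ⟨j, hj, z, hz, rfl⟩ | ⟨l, rfl, i, hi, z, hz, rfl⟩
      · have hle : Submodule.span R (F : Set S) ≤ (Submodule.span R ((F₁ ∪ F₂ : Finset S) :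
            Set S)).comap (LinearMap.mulRight R ((T.up k j : S) * z)) := by
          refine Submodule.span_le.2 fun w hw => Submodule.subset_span ?_
          refine Finset.mem_union_left _ (Finset.mem_biUnion.2 ⟨j, Finset.mem_range.2 (by omega),
            Finset.mem_image.2 ⟨(z, w), Finset.mem_product.2 ⟨by simpa [dotsInv] using hz, hw⟩, ?_⟩⟩)
          simp [mul_assoc]
        simpa [mul_assoc] using hle hb'
      · have hle : Submodule.span R (F : Set S) ≤ (Submodule.span R ((F₁ ∪ F₂ : Finset S) :
            Set S)).comap (LinearMap.mulLeft R (z * (T.down l i : S) * T.e l)) := by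
          refine Submodule.span_le.2 fun w hw => Submodule.subset_span ?_
          refine Finset.mem_union_right _ (Finset.mem_biUnion.2 ⟨i, Finset.mem_range.2 (by omega),
            Finset.mem_image.2 ⟨(z, w), Finset.mem_product.2 ⟨by simpa [dots] using hz, hw⟩, ?_⟩⟩)
          simp [mul_assoc]
        simpa [mul_assoc] using hle hb'

end TypeBRep

end BMW

/-! ### Application to the algebra given by generators and relations. -/

namespace BMW

section final

variable {R : Type*} [CommRing R] (p : ParamsB R) (n : ℕ)

theorem mkB_rel {a b : FreeAlgebra R (GenB n)} (h : RelB p n a b) : mkB p n a = mkB p n b :=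
  RingQuot.mkAlgHom_rel R h

theorem mkB_ge (i : Fin (n - 1)) :
    mkB p n (ge p.toParamsA i) = cupCap p.toParamsA (X p i) := by
  rw [map_eOf]; rfl

theorem isKauffman_X (i : Fin (n - 1)) : IsKauffman p.toParamsA (X p i) := by
  constructor
  · have := mkB_rel p n (RelB.X_mul_e i)
    rwa [map_mul, map_smul, mkB_ge] at this
  · have := mkB_rel p n (RelB.e_mul_X i)
    rwa [map_mul, map_smul, mkB_ge] at this

theorem isKauffmanPair_X (i j : Fin (n - 1)) (h : (i : ℕ) + 1 = j) :
    IsKauffmanPair p.toParamsA (X p i) (X p j) := by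
  refine ⟨isKauffman_X p n i, isKauffman_X p n j, ?_, ?_, ?_⟩
  · have := mkB_rel p n (RelB.braid i j (Or.inl h))
    simp only [map_mul] at this
    exact Units.ext this
  · have := mkB_rel p n (RelB.e_X_e j i h)
    rwa [map_mul, map_mul, map_smul, mkB_ge] at this
  · have := mkB_rel p n (RelB.e_Xinv_e j i h)
    rwa [map_mul, map_mul, map_smul, mkB_ge] at this

/-- The generators of the type B algebra on `n` strands. -/
def standardRep : TypeBRep p (BB p n) (n - 1) where
  -- The value `1` outside the range is arbitrary; the relations only concern indices below `n - 1`.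
  X i := if h : i < n - 1 then X p ⟨i, h⟩ else 1
  Y := Y p n
  kauffman i hi := by
    rw [dif_pos hi]; exact isKauffman_X p n _
  comm i j hij hj := by
    rw [dif_pos hj, dif_pos (show i < n - 1 by omega)]
    have := mkB_rel p n (RelB.comm ⟨i, by omega⟩ ⟨j, hj⟩ (Or.inl hij))
    simp only [map_mul] at this
    exact Units.ext this
  pair i hi := by
    rw [dif_pos hi, dif_pos (show i < n - 1 by omega)]
    exact isKauffmanPair_X p n _ _ rfl
  X_Y_X_Y h := by
    rw [dif_pos h]
    have := mkB_rel p n (RelB.XYXY ⟨0, h⟩ rfl)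
    simp only [map_mul] at this
    exact Units.ext this
  Y_sq := by
    have := mkB_rel p n RelB.Y_sq
    rwa [map_mul, map_add, map_smul, AlgHom.commutes] at this
  Y_X_Y_e h := by
    rw [dif_pos h]
    have := mkB_rel p n (RelB.YXYe ⟨0, h⟩ rfl)
    rwa [map_mul, map_mul, map_mul, mkB_ge] at this
  Y_comm i h hi := by
    rw [dif_pos hi]
    have := mkB_rel p n (RelB.Y_comm ⟨i, hi⟩ h)
    simp only [map_mul] at this
    exact Units.ext this

theorem standardRep_X {i : ℕ} (h : i < n - 1) : (standardRep p n).X i = X p ⟨i, h⟩ :=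
  dif_pos h

theorem standardRep_J {k : ℕ} (h : k < n) : (standardRep p n).J k = yPrime p ⟨k, h⟩ := by
  induction k with
  | zero => rfl
  | succ k ih =>
    rw [TypeBRep.J_succ, ih (by omega), standardRep_X p n (by omega)]; rfl

/-- The free generators include formal inverses; these lie in the subalgebra by the cubic relation
for `X i` and the quadratic one for `Y`. -/
theorem standardRep_algB (hn : 1 ≤ n) : (standardRep p n).algB n = ⊤ := by
  have h1 : (⊤ : Subalgebra R (BB p n)) = (⊤ : Subalgebra R (FreeAlgebra R (GenB n))).map
      (mkB p n) := by
    rw [Algebra.map_top]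
    exact ((AlgHom.range_eq_top _).2 (RingQuot.mkAlgHom_surjective R _)).symm
  rw [eq_top_iff, h1, ← FreeAlgebra.adjoin_range_ι, AlgHom.map_adjoin, Algebra.adjoin_le_iff]
  rintro _ ⟨_, ⟨g, rfl⟩, rfl⟩
  cases g with
  | X i =>
    have := (standardRep p n).X_mem (k := n) (l := i) (by omega)
    rwa [standardRep_X p n i.2] at this
  | Xinv i =>
    have := (standardRep p n).X_inv_mem (k := n) (l := i) i.2 (by omega)
    rwa [standardRep_X p n i.2] at this
  | Y => exact (standardRep p n).Y_mem hn
  | Yinv => exact (standardRep p n).Y_inv_mem hn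

theorem standardRep_algA_le : (standardRep p n).algA n ≤ (toBB p n).range := by
  rw [TypeBRep.algA, Algebra.adjoin_le_iff]
  rintro _ ⟨l, hl, rfl⟩
  refine ⟨RingQuot.mkAlgHom R (RelA p.toParamsA n) (fX R ⟨l, by omega⟩), ?_⟩
  rw [standardRep_X p n (by omega)]
  exact (RingQuot.liftAlgHom_mkAlgHom_apply R _ _ _).trans
    (congrArg (mkB p n) (freeAtoB_X (R := R) (⟨l, by omega⟩ : Fin (n - 1))))

theorem nodupForms_subset_normalForms :
    (standardRep p n).nodupForms n ⊆ normalForms p n Set.univ := by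
  rintro _ ⟨s, t, -, -, hs, ht, hlen, b, hb, rfl⟩
  obtain ⟨b, rfl⟩ := standardRep_algA_le p n hb
  refine ⟨s.attachWith _ hs |>.map fun i => ⟨i.1, i.2⟩,
    t.attachWith _ ht |>.map fun i => ⟨i.1, i.2⟩, b, trivial, by simpa using hlen, ?_⟩
  have e1 : (((s.map (standardRep p n).J).prod : (BB p n)ˣ) : BB p n) =
      ((s.attachWith _ hs |>.map fun i => (⟨i.1, i.2⟩ : Fin n)).map
        fun k => (yPrime p k : BB p n)).prod := by
    rw [← Units.coeHom_apply, map_list_prod, List.map_map, List.map_map]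
    congr 1
    conv_lhs => rw [← List.attachWith_map_subtype_val hs, List.map_map]
    refine List.map_congr_left fun i _ => ?_
    simp [standardRep_J p n i.2]
  have e2 : (((t.map fun i => ((standardRep p n).J i)⁻¹).prod : (BB p n)ˣ) : BB p n) =
      ((t.attachWith _ ht |>.map fun i => (⟨i.1, i.2⟩ : Fin n)).map
        fun k => (((yPrime p k)⁻¹ : (BB p n)ˣ) : BB p n)).prod := by
    rw [← Units.coeHom_apply, map_list_prod, List.map_map, List.map_map]
    congr 1
    conv_lhs => rw [← List.attachWith_map_subtype_val ht, List.map_map]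
    refine List.map_congr_left fun i _ => ?_
    simp [standardRep_J p n i.2]
  rw [e1, e2]
  rfl

/-- Normal forms are spanned by the normal forms over any spanning set of the type A algebra. -/
theorem normalForms_univ_subset_span {B : Set (BA p.toParamsA n)}
    (hB : Submodule.span R B = ⊤) :
    normalForms p n Set.univ ⊆ Submodule.span R (normalForms p n B) := by
  rintro _ ⟨s, t, b, -, hlen, rfl⟩
  have hb : b ∈ Submodule.span R B := hB ▸ Submodule.mem_top
  induction hb using Submodule.span_induction with
  | mem b hb => exact Submodule.subset_span ⟨s, t, b, hb, hlen, rfl⟩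
  | zero => simp
  | add b c _ _ hb hc =>
    rw [map_add, mul_add, add_mul]; exact Submodule.add_mem _ hb hc
  | smul r b _ hb =>
    rw [map_smul, mul_smul_comm, smul_mul_assoc]; exact Submodule.smul_mem _ _ hb

open scoped Nat in
theorem exists_finset_normalForms (hn : 1 ≤ n) :
    ∃ F : Finset (BB p n), (F : Set (BB p n)) ⊆ normalForms p n Set.univ ∧
      F.card ≤ 2 ^ n * (2 * n - 1)‼ ∧ Submodule.span R (F : Set (BB p n)) = ⊤ := by
  obtain ⟨F, h1, h2, h3⟩ := (standardRep p n).exists_finset_nodupForms (k := n) (by omega)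
  refine ⟨F, h1.trans (nodupForms_subset_normalForms p n), h2, ?_⟩
  rw [standardRep_algB p n hn] at h3
  exact top_le_iff.1 h3

end final

end BMW

/-! ### Spanning, rank and basis statements. -/

open scoped Nat in
theorem mainTheorem3 {R : Type*} [CommRing R] [IsDomain R] (p : BMW.ParamsB R)
    (hA : p.A * (1 - (p.q0 : R) * (p.lam : R)) = p.q1 * (p.x : R))
    (hq0 : p.q0 = p.q⁻¹) (n : ℕ) (hn : 1 ≤ n) :
    (∀ B : Set (BMW.BA p.toParamsA n), Submodule.span R B = ⊤ →
      Submodule.span R (BMW.normalForms p n B) = ⊤) ∧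
    (∃ S : Finset (BMW.BB p n), (S : Set (BMW.BB p n)) ⊆ BMW.normalForms p n Set.univ ∧
      S.card ≤ 2 ^ n * (2 * n - 1)‼ ∧ Submodule.span R (S : Set (BMW.BB p n)) = ⊤) ∧
    Module.rank R (BMW.BB p n) ≤ ((2 ^ n * (2 * n - 1)‼ : ℕ) : Cardinal) ∧
    (IsField R →
      ∀ B : Set (BMW.BA p.toParamsA n), LinearIndepOn R id B → Submodule.span R B = ⊤ →
        ∃ C : Set (BMW.BB p n), C ⊆ BMW.normalForms p n B ∧ LinearIndepOn R id C ∧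
          Submodule.span R C = ⊤ ∧ C.Finite ∧ C.ncard ≤ 2 ^ n * (2 * n - 1)‼) := by
  obtain ⟨F, hF, hcard, hspan⟩ := BMW.exists_finset_normalForms p n hn
  have hnormal : ∀ B : Set (BMW.BA p.toParamsA n), Submodule.span R B = ⊤ →
      Submodule.span R (BMW.normalForms p n B) = ⊤ := fun B hB => by
    rw [eq_top_iff, ← hspan, Submodule.span_le]
    exact hF.trans (BMW.normalForms_univ_subset_span p n hB)
  have hrank : Module.rank R (BMW.BB p n) ≤ ((2 ^ n * (2 * n - 1)‼ : ℕ) : Cardinal) := by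
    rw [← rank_top, ← hspan]
    exact (rank_span_finset_le F).trans (by exact_mod_cast hcard)
  refine ⟨hnormal, ⟨F, hF, hcard, hspan⟩, hrank, fun hR B _ hB => ?_⟩
  -- Over a field the spanning set of normal forms contains a basis, and its size is bounded by the
  -- rank.
  let _ := hR.toField
  obtain ⟨C, hC, hspanC, hind⟩ := exists_linearIndependent R (BMW.normalForms p n B)
  rw [hnormal B hB] at hspanC
  have hCrank : Cardinal.mk C ≤ ((2 ^ n * (2 * n - 1)‼ : ℕ) : Cardinal) :=
    hind.cardinal_le_rank.trans hrank
  have hfin : C.Finite := Cardinal.lt_aleph0_iff_set_finite.1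
    (hCrank.trans_lt (Cardinal.natCast_lt_aleph0))
  refine ⟨C, hC, hind, hspanC, hfin, ?_⟩
  rw [← Set.cast_ncard hfin] at hCrank
  exact_mod_cast hCrank
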